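/- Let $d\ge 1$, let $\Omega\subset\mathbb R^d$ be a bounded convex body (a compact convex set with non-empty interior), let $q\in\mathbb R$ and $P(D)=D^2+q$. Let $W=W^{P(D)}_\infty(\Omega)$ be the class of all $f\in C^1(\Omega)$ such that for every unit vector $u\in\mathbb R^d$ the second directional derivative $\partial^2 f/\partial u^2$ exists inside $\Omega$ in the generalized (weak) sense and $\left\|\frac{\partial^2 f}{\partial u^2}+q f\right\|_{L_\infty(\Omega)}\le 1$. For a finite set $\xi\subset\Omega$ let $I_\xi(f)=\{(f(x),\nabla f(x)):x\in\xi\}$, and let $$R_n(W)=\inf_{\xi\subset\Omega,\ \operatorname{card}\xi\le n}\ \inf_{\phi}\ \sup_{f\in W}\|f-\phi(I_\xi(f))\|_{L_\infty(\Omega)}$$ be the $n$-th optimal error, where $\phi$ runs over all maps $\phi:I_\xi(W)\to C(\Omega)$. Then $$R_n(W)=\frac14\left(\frac{\operatorname{dens}(d)\,\mu_d(\Omega)}{\nu_d\,n}\right)^{2/d}(1+o(1))\qquad\text{as } n\to\infty .$$ Here $\mu_d$ is Lebesgue measure on $\mathbb R^d$, $\nu_d$ is the volume of the unit ball of $\mathbb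 R^d$, and $\operatorname{dens}(d)$ is the least density of a sphere covering: the infimum of $$\liminf_{R\to\infty}\frac{\sum_{B\in\mathcal M}\mu_d(B\cap[-R,R]^d)}{\mu_d([-R,R]^d)}$$ over all countable collections $\mathcal M$ of balls of equal positive radius whose union is $\mathbb R^d$. -/

import Mathlib

open Filter Topology MeasureTheory Set
open scoped ENNReal ContDiff

namespace OptimalRecovery

/-- `ℝ^d` with the Euclidean norm. -/
abbrev E (d : ℕ) : Type := EuclideanSpace ℝ (Fin d)

/-! ### The least density of sphere coverings -/

/-- The balls of common radius `r > 0` centred at the points of the countable set `S`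
cover `ℝ^d`. -/
def IsSphereCovering (d : ℕ) (S : Set (E d)) (r : ℝ) : Prop :=
  S.Countable ∧ 0 < r ∧ (⋃ c ∈ S, Metric.closedBall c r) = Set.univ

/-- The cube `[-R, R]^d`. -/
def cube (d : ℕ) (R : ℝ) : Set (E d) := {x | ∀ i, x i ∈ Set.Icc (-R) R}

/-- The density of the collection of balls of radius `r` centred at the points of `S`:
`liminf_{R → ∞} (∑_B μ(B ∩ [-R,R]^d)) / μ([-R,R]^d)`, a number in `[0, ∞]`. -/
noncomputable def coveringDensity (d : ℕ) (S : Set (E d)) (r : ℝ) : ℝ≥0∞ :=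
  Filter.liminf
    (fun R : ℝ =>
      (∑' c : S, volume (Metric.closedBall (c : E d) r ∩ cube d R)) / volume (cube d R))
    atTop

/-- `dens(d)`: the infimum of the densities of all coverings of `ℝ^d` by equal balls. -/
noncomputable def dens (d : ℕ) : ℝ≥0∞ :=
  ⨅ (S : Set (E d)) (r : ℝ) (_ : IsSphereCovering d S r), coveringDensity d S r

/-! ### The function class -/

/-- `g` is the generalized (weak) second directional derivative of `f` in the direction `u`
on the set `U` (used for open `U`): `g` is locally integrable on `U`, and
`∫ f ∂²φ/∂u² = ∫ g φ` for all smooth `φ` with compact support inside `U`. -/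
def IsWeakSecondDeriv {d : ℕ} (U : Set (E d)) (f : E d → ℝ) (u : E d) (g : E d → ℝ) : Prop :=
  LocallyIntegrableOn g U volume ∧
    ∀ φ : E d → ℝ, ContDiff ℝ ∞ φ → HasCompactSupport φ → tsupport φ ⊆ U →
      ∫ x in U, f x * fderiv ℝ (fun y => fderiv ℝ φ y u) x u = ∫ x in U, g x * φ x

/-- The class `W^{P(D)}_∞(Ω)` for `P(D) = D² + p D + q`: functions `f` that are `C¹` on `Ω` and
that have, for every unit vector `u`, a generalized second derivative `g = ∂²f/∂u²` inside `Ω`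
with `‖g + p ∂f/∂u + q f‖_{L∞(Ω)} ≤ 1`.
A function on `Ω` is represented by any extension of it to `ℝ^d`; only its values on `Ω` enter. -/
def W {d : ℕ} (p q : ℝ) (Ω : Set (E d)) : Set (E d → ℝ) :=
  {f | ContDiffOn ℝ 1 f Ω ∧
    ∀ u : E d, ‖u‖ = 1 → ∃ g : E d → ℝ, IsWeakSecondDeriv (interior Ω) f u g ∧
      eLpNorm (fun x => g x + p * fderivWithin ℝ f Ω x u + q * f x) ∞ (volume.restrict Ω) ≤ 1}

/-! ### Optimal recovery from function and gradient values -/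

/-- The information `I_ξ(f) = {f(x), ∇f(x) : x ∈ ξ}`. At a boundary point of `Ω` the gradient is
the one relative to `Ω` (unique when `Ω` is convex with nonempty interior). -/
noncomputable def info {d : ℕ} (Ω : Set (E d)) (ξ : Finset (E d)) (f : E d → ℝ) :
    ξ → ℝ × E d :=
  fun x => (f x, gradientWithin f Ω (x : E d))

/-- The worst-case error over `F` of the algorithm `φ`, which assigns to each possible data
vector a continuous function on `Ω`; the error is measured in the essential supremum norm for
the Lebesgue measure on `Ω`.
Only the values of `φ` on `I_ξ(F)` enter. -/
noncomputable def worstCaseError {d : ℕ} (Ω : Set (E d)) (F : Set (E d → ℝ))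
    (ξ : Finset (E d)) (φ : (ξ → ℝ × E d) → C(Ω, ℝ)) : ℝ≥0∞ :=
  ⨆ f ∈ F, eLpNorm (fun x : Ω => f x - φ (info Ω ξ f) x) ∞
    (Measure.comap (Subtype.val : Ω → E d) volume)

/-- The optimal error `R(F, ξ)`: the infimum of the worst-case errors over all algorithms. -/
noncomputable def optimalError {d : ℕ} (Ω : Set (E d)) (F : Set (E d → ℝ))
    (ξ : Finset (E d)) : ℝ≥0∞ :=
  ⨅ φ : (ξ → ℝ × E d) → C(Ω, ℝ), worstCaseError Ω F ξ φ

/-- The `n`-th optimal error `R_n(F)`: the infimum of `R(F, ξ)` over all node sets `ξ ⊆ Ω` with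
at most `n` points. -/
noncomputable def nthOptimalError {d : ℕ} (Ω : Set (E d)) (F : Set (E d → ℝ)) (n : ℕ) : ℝ≥0∞ :=
  ⨅ (ξ : Finset (E d)) (_ : (ξ : Set (E d)) ⊆ Ω) (_ : ξ.card ≤ n), optimalError Ω F ξ

end OptimalRecovery

/-!
The error of recovery is governed by the covering radius of the node set, and `dens d`
determines how small the covering radius of `n` nodes can be.

*Upper bound for given nodes.* A member `w` of the class with `|w| ≤ M` has weak second directional
derivatives bounded by `K = 1 + |q| M`. Mollification turns this into convexity of `K ‖x‖² / 2 ± w`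
along segments and hence into Taylor's inequality `taylor_of_mem_W`, valid up to the boundary.
Let the nodes be such that the balls of radius `h` around them cover the `h`-ball around `y`. Then
`y = ∑ lₓ x` is a convex combination of nodes with `∑ lₓ ‖x - y‖² ≤ h²`
(`exists_weights_of_covering`); otherwise a hyperplane in `ℝ^d × ℝ` would separate the ray
`{0} × (-∞, h²]` from all the points `(x - y, ‖x - y‖²)`, and a point of the `h`-ball around `y`
depending on the normal of the hyperplane would have no node within distance `h`. If `w` and its
gradient vanish at the nodes, Taylor expansion at the midpoints `(x + y) / 2`, once from the node
`x` and once from `y`,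
gives `|w y| ≤ K h² / 4` after averaging: the factor `1 / 4` instead of `1 / 2` comes from the
midpoints. Taking `M = sup |w|` absorbs the zero order term, so `M ≤ (h² / 4) / (1 - |q| h² / 4)`.
Differences of members with the same data obey this bound up to the factor `2` and are
equi-Lipschitz, so the lowered upper envelope of all members with given data is a continuous
approximation with error `M` (`optimalError_le_of_zero_data`). Near the boundary the covering
condition may fail, but there a single node at distance `h / 2` suffices.

*Lower bound for given nodes.* If some `h`-ball centred in the body has no nodes, the radial
function whose radial derivative is minus a tent of height `h / 2` has a `1`-Lipschitz gradient and
the value `h² / 4` at the centre; after a small rescaling it and its negative belong to the class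
and have zero data (`le_optimalError_of_empty_ball`).

*Counting.* Averaging over translates shows that a covering of the space of nearly least density
can be scaled and translated so as to have at most `(dens d + δ) μ(Ω) / (ν_d h^d)` centres in the
body (`exists_covering_card_le`), and the boundary layer needs only `o(h^(-d))` more nodes
(`exists_nodes`). Conversely, for `n` balls of radius `h` that cover the body, averaging gives a
cube inside the body with at most its share of the centres; repeating it periodically yields a
covering of the space (`dens_mul_le_of_cover_cube`), whence `n ≥ (dens d - δ) μ(Ω) / (ν_d h^d)` for
small `h` (`le_card_of_cover`). Comparing both bounds at `h = (κ / n)^(1/d)` with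
`κ = dens d * μ(Ω) / ν_d` gives the theorem.
-/

namespace OptimalRecovery

variable {d : ℕ}

/-! ### Mollification and semiconvexity -/

section Mollification

open scoped Convolution

theorem hasDerivAt_convolution_line {F ψ : E d → ℝ} (hF : LocallyIntegrable F volume)
    (hψ : ContDiff ℝ 1 ψ) (hc : HasCompactSupport ψ) (a u : E d) (t : ℝ) :
    HasDerivAt (fun t : ℝ => (F ⋆[ContinuousLinearMap.mul ℝ ℝ, volume] ψ) (a + t • u))
      ((F ⋆[ContinuousLinearMap.mul ℝ ℝ, volume] fun y => fderiv ℝ ψ y u) (a + t • u)) t := by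
  have h1 := hc.hasFDerivAt_convolution_right (ContinuousLinearMap.mul ℝ ℝ) hF hψ (a + t • u)
  have h2 : HasDerivAt (fun t : ℝ => a + t • u) u t := by
    simpa using ((hasDerivAt_id t).smul_const u).const_add a
  have h3 := h1.comp_hasDerivAt t h2
  rwa [convolution_precompR_apply (ContinuousLinearMap.mul ℝ ℝ) hF (hc.fderiv ℝ)
    (hψ.continuous_fderiv one_ne_zero)] at h3

theorem integrableOn_mul_of_hasCompactSupport {U : Set (E d)} (hU : MeasurableSet U)
    {g φ : E d → ℝ}
    (hg : LocallyIntegrableOn g U volume) (hφ : Continuous φ) (hc : HasCompactSupport φ)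
    (hs : tsupport φ ⊆ U) : IntegrableOn (fun x => g x * φ x) U volume := by
  have h1 : IntegrableOn (fun x => g x * φ x) (tsupport φ) volume :=
    (hg.integrableOn_compact_subset hs hc).mul_continuousOn hφ.continuousOn hc
  refine h1.of_forall_sdiff_eq_zero hU fun x hx => ?_
  rw [image_eq_zero_of_notMem_tsupport hx.2, mul_zero]

/-- A weak second derivative bounded below by `-K` gives the same bound for the classical second
derivative of a mollification. -/
theorem neg_le_convolution_fderiv_fderiv {U : Set (E d)} (hU : IsOpen U) {f g : E d → ℝ}
    {u : E d} (hg : IsWeakSecondDeriv U f u g) {K : ℝ}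
    (hK : ∀ᵐ x ∂volume.restrict U, -K ≤ g x) (ρ : ContDiffBump (0 : E d)) {x : E d}
    (hx : Metric.closedBall x ρ.rOut ⊆ U) :
    -K ≤ (U.indicator f ⋆[ContinuousLinearMap.mul ℝ ℝ, volume]
      fun y => fderiv ℝ (fun z => fderiv ℝ (ρ.normed volume) z u) y u) x := by
  have hρ : ContDiff ℝ ∞ (ρ.normed volume) := ρ.contDiff_normed
  have hρ' : Differentiable ℝ (ρ.normed volume) := hρ.differentiable (by simp)
  have hρ2 : Differentiable ℝ (fun z => fderiv ℝ (ρ.normed volume) z u) := by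
    have : ContDiff ℝ 1 (fun z => fderiv ℝ (ρ.normed volume) z u) :=
      ((contDiff_infty.1 hρ 2).fderiv_right (m := 1) (by norm_num)).clm_apply contDiff_const
    exact this.differentiable one_ne_zero
  -- The second derivative of the mollification at `x` is the pairing of `f` with that of `φ`.
  set φ : E d → ℝ := fun t => ρ.normed volume (x - t) with hφdef
  have hφ : ContDiff ℝ ∞ φ := hρ.comp (contDiff_const.sub contDiff_id)
  have hts : tsupport φ ⊆ Metric.closedBall x ρ.rOut := by
    refine closure_minimal (fun t ht => ?_) Metric.isClosed_closedBall
    have : x - t ∈ Metric.ball (0 : E d) ρ.rOut := by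
      rw [← ρ.support_normed_eq (μ := volume)]; exact ht
    rw [mem_ball_zero_iff] at this
    rw [Metric.mem_closedBall, dist_comm, dist_eq_norm]
    exact this.le
  have hcs : HasCompactSupport φ :=
    (isCompact_closedBall x ρ.rOut).of_isClosed_subset (isClosed_tsupport _) hts
  have hneg : ∀ t : E d, HasFDerivAt (fun t : E d => x - t)
      (-(ContinuousLinearMap.id ℝ (E d))) t := fun t => (hasFDerivAt_id t).const_sub x
  have hd1 : ∀ t, fderiv ℝ φ t u = - fderiv ℝ (ρ.normed volume) (x - t) u := by
    intro t
    have := ((hρ' (x - t)).hasFDerivAt.comp t (hneg t)).fderiv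
    rw [show φ = (ρ.normed volume) ∘ (fun t => x - t) from rfl, this]
    simp
  have hd2 : ∀ t, fderiv ℝ (fun z => fderiv ℝ φ z u) t u =
      fderiv ℝ (fun z => fderiv ℝ (ρ.normed volume) z u) (x - t) u := by
    intro t
    simp_rw [hd1]
    have := (((hρ2 (x - t)).hasFDerivAt.comp t (hneg t)).neg).fderiv
    erw [this]
    simp
  have hkey := hg.2 φ hφ hcs (hts.trans hx)
  have hconv : (U.indicator f ⋆[ContinuousLinearMap.mul ℝ ℝ, volume]
      fun y => fderiv ℝ (fun z => fderiv ℝ (ρ.normed volume) z u) y u) x = ∫ y in U, g y * φ y := by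
    rw [← hkey, convolution_def, ← integral_indicator hU.measurableSet]
    congr 1
    ext t
    by_cases ht : t ∈ U <;> simp [ht, hd2]
  rw [hconv]
  have hφ1 : ∫ y in U, φ y = 1 := by
    rw [setIntegral_eq_integral_of_forall_compl_eq_zero]
    · rw [integral_sub_left_eq_self (ρ.normed volume) volume x]
      exact ρ.integral_normed
    · intro y hy
      exact image_eq_zero_of_notMem_tsupport fun h => hy (hx (hts h))
  calc -K = ∫ y in U, -K * φ y := by rw [integral_const_mul, hφ1, mul_one]
    _ ≤ ∫ y in U, g y * φ y := by
      refine setIntegral_mono_ae_restrict ?_ ?_ ?_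
      · exact ((hφ.continuous.integrable_of_hasCompactSupport hcs).const_mul _).integrableOn
      · exact integrableOn_mul_of_hasCompactSupport hU.measurableSet hg.1 hφ.continuous hcs
          (hts.trans hx)
      · filter_upwards [hK] with y hy
        exact mul_le_mul_of_nonneg_right hy (ρ.nonneg_normed _)

theorem convexOn_convolution_line {U : Set (E d)} (hU : IsOpen U) {f g : E d → ℝ}
    (hfi : IntegrableOn f U volume) {u : E d} (hg : IsWeakSecondDeriv U f u g) {K : ℝ}
    (hK : ∀ᵐ x ∂volume.restrict U, -K ≤ g x) (ρ : ContDiffBump (0 : E d)) {a : E d} {T : ℝ}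
    (hball : ∀ t ∈ Icc 0 T, Metric.closedBall (a + t • u) ρ.rOut ⊆ U) :
    ConvexOn ℝ (Icc 0 T) (fun t => (U.indicator f ⋆[ContinuousLinearMap.mul ℝ ℝ, volume]
      ρ.normed volume) (a + t • u) + K / 2 * t ^ 2) := by
  have hloc : LocallyIntegrable (U.indicator f) volume :=
    (hfi.integrable_indicator hU.measurableSet).locallyIntegrable
  have hρ : ContDiff ℝ ∞ (ρ.normed volume : E d → ℝ) := ρ.contDiff_normed
  have hρc : HasCompactSupport (ρ.normed volume : E d → ℝ) := ρ.hasCompactSupport_normed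
  have hρ' : ContDiff ℝ 1 (fun z => fderiv ℝ (ρ.normed volume) z u) :=
    ((contDiff_infty.1 hρ 2).fderiv_right (m := 1) (by norm_num)).clm_apply contDiff_const
  have hρc' : HasCompactSupport (fun z => fderiv ℝ (ρ.normed volume) z u) :=
    (hρc.fderiv ℝ).comp_left (g := fun L : E d →L[ℝ] ℝ => L u) (by simp)
  have hq : ∀ t : ℝ, HasDerivAt (fun t => K / 2 * t ^ 2) (K * t) t := fun t => by
    exact ((hasDerivAt_pow 2 t).const_mul (K / 2)).congr_deriv (by simp; ring)
  have hq' : ∀ t : ℝ, HasDerivAt (fun t => K * t) K t := fun t => by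
    simpa using (hasDerivAt_id t).const_mul K
  have hd1 := fun t : ℝ =>
    (hasDerivAt_convolution_line hloc (hρ.of_le (by simp)) hρc a u t).add (hq t)
  have hd2 := fun t : ℝ => (hasDerivAt_convolution_line hloc hρ' hρc' a u t).add (hq' t)
  refine convexOn_of_hasDerivWithinAt2_nonneg (convex_Icc 0 T)
    (fun t _ => (hd1 t).continuousAt.continuousWithinAt)
    (fun t _ => (hd1 t).hasDerivWithinAt) (fun t _ => (hd2 t).hasDerivWithinAt) ?_
  intro t ht
  have := neg_le_convolution_fderiv_fderiv hU hg hK ρ (hball t (interior_subset ht))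
  linarith

/-- A continuous function whose weak second derivative in direction `u` is at least `-K` becomes
convex along `u` after adding `K t ^ 2 / 2`. -/
theorem semiconvex_of_isWeakSecondDeriv {U : Set (E d)} (hU : IsOpen U) {f g : E d → ℝ}
    (hf : ContinuousOn f U) (hfi : IntegrableOn f U volume) {u : E d}
    (hg : IsWeakSecondDeriv U f u g) {K : ℝ}
    (hK : ∀ᵐ x ∂volume.restrict U, -K ≤ g x) {a : E d} {T : ℝ}
    (hseg : ∀ t ∈ Icc 0 T, a + t • u ∈ U) :
    ConvexOn ℝ (Icc 0 T) (fun t => f (a + t • u) + K / 2 * t ^ 2) := by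
  have hcont : Continuous fun t : ℝ => a + t • u := by fun_prop
  obtain ⟨δ, hδ, hδU⟩ : ∃ δ > 0, ∀ t ∈ Icc 0 T, Metric.closedBall (a + t • u) δ ⊆ U := by
    have hcomp : IsCompact ((fun t : ℝ => a + t • u) '' Icc 0 T) := isCompact_Icc.image hcont
    obtain ⟨δ, hδ, h⟩ := hcomp.exists_cthickening_subset_open hU
      (by rintro _ ⟨t, ht, rfl⟩; exact hseg t ht)
    exact ⟨δ, hδ, fun t ht => (Metric.closedBall_subset_cthickening
      (mem_image_of_mem (fun t : ℝ => a + t • u) ht) δ).trans h⟩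
  have hloc : LocallyIntegrable (U.indicator f) volume :=
    (hfi.integrable_indicator hU.measurableSet).locallyIntegrable
  obtain ⟨ρ, hρlim, hρle⟩ : ∃ ρ : ℕ → ContDiffBump (0 : E d),
      Tendsto (fun n => (ρ n).rOut) atTop (𝓝 0) ∧ ∀ n, (ρ n).rOut ≤ δ := by
    refine ⟨fun n => ⟨δ / (n + 2), δ / (n + 1), by positivity, by gcongr; norm_num⟩, ?_,
      fun n => div_le_self hδ.le (by simp)⟩
    have h := (tendsto_one_div_add_atTop_nhds_zero_nat (𝕜 := ℝ)).const_mul δ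
    simpa only [mul_one_div, mul_zero] using h
  obtain ⟨G, hG⟩ : ∃ G : ℕ → E d → ℝ, ∀ n, G n =
    U.indicator f ⋆[ContinuousLinearMap.mul ℝ ℝ, volume] (ρ n).normed volume := ⟨_, fun _ => rfl⟩
  have hGlim : ∀ x ∈ U, Tendsto (fun n => G n x) atTop (𝓝 (f x)) := by
    intro x hx
    have h1 := ContDiffBump.convolution_tendsto_right (μ := (volume : Measure (E d)))
      (φ := ρ) (g := fun _ => U.indicator f) (k := fun _ => x) (x₀ := x) (z₀ := f x) hρlim
      (Eventually.of_forall fun _ => hloc.aestronglyMeasurable) ?_ tendsto_const_nhds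
    · refine h1.congr fun n => ?_
      rw [hG, ← convolution_flip]
      congr 1
      ext; simp
    · have h2 : ContinuousAt (U.indicator f) x :=
        ((hf.continuousAt (hU.mem_nhds hx))).congr (by
          filter_upwards [hU.mem_nhds hx] with y hy using (indicator_of_mem hy f).symm)
      have h3 : Tendsto (U.indicator f) (𝓝 x) (𝓝 (f x)) := by
        simpa [ContinuousAt, hx] using h2
      exact h3.comp tendsto_snd
  have hGconv : ∀ n, ConvexOn ℝ (Icc 0 T) (fun t => G n (a + t • u) + K / 2 * t ^ 2) := fun n => by
    rw [hG]
    exact convexOn_convolution_line hU hfi hg hK (ρ n) fun t ht =>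
      (Metric.closedBall_subset_closedBall (hρle n)).trans (hδU t ht)
  refine ⟨convex_Icc 0 T, fun s hs t ht α β hα hβ hαβ => ?_⟩
  have hst : α • s + β • t ∈ Icc 0 T := (convex_Icc 0 T) hs ht hα hβ hαβ
  have hl : ∀ r ∈ Icc 0 T, Tendsto (fun n => G n (a + r • u) + K / 2 * r ^ 2) atTop
      (𝓝 (f (a + r • u) + K / 2 * r ^ 2)) := fun r hr => (hGlim _ (hseg r hr)).add_const _
  exact le_of_tendsto_of_tendsto' (hl _ hst) (((hl s hs).const_smul α).add ((hl t ht).const_smul β))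
    fun n => (hGconv n).2 hs ht hα hβ hαβ

end Mollification

/-! ### Taylor's inequality for members of the class -/

theorem IsWeakSecondDeriv.neg {U : Set (E d)} {f g : E d → ℝ} {u : E d}
    (h : IsWeakSecondDeriv U f u g) : IsWeakSecondDeriv U (-f) u (-g) := by
  refine ⟨h.1.neg, fun φ h1 h2 h3 => ?_⟩
  have := h.2 φ h1 h2 h3
  simp only [Pi.neg_apply, neg_mul, integral_neg, this]

/-- Quantitative convexity defect on an open convex set, from one-sided bounds on the weak second
directional derivatives. -/
theorem le_combo_of_isWeakSecondDeriv {U : Set (E d)} (hU : IsOpen U) (hconv : Convex ℝ U)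
    {f : E d → ℝ} (hf : ContinuousOn f U) (hfi : IntegrableOn f U volume) {K : ℝ}
    (hg : ∀ u : E d, ‖u‖ = 1 → ∃ g, IsWeakSecondDeriv U f u g ∧
      ∀ᵐ x ∂volume.restrict U, -K ≤ g x) {a b : E d} (ha : a ∈ U) (hb : b ∈ U) {s : ℝ}
    (hs : s ∈ Icc (0 : ℝ) 1) :
    f (a + s • (b - a)) ≤ (1 - s) * f a + s * f b + K / 2 * (s * (1 - s) * ‖b - a‖ ^ 2) := by
  rcases eq_or_ne a b with rfl | hab
  · simp only [sub_self, smul_zero, add_zero, norm_zero]; apply le_of_eq; ring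
  have hT : 0 < ‖b - a‖ := norm_pos_iff.2 (sub_ne_zero.2 hab.symm)
  set T := ‖b - a‖ with hTdef
  obtain ⟨g, hg1, hg2⟩ := hg (T⁻¹ • (b - a)) (by
    rw [norm_smul, norm_inv, norm_norm, ← hTdef, inv_mul_cancel₀ hT.ne'])
  have hpt : ∀ r : ℝ, a + (r * T) • (T⁻¹ • (b - a)) = a + r • (b - a) := fun r => by
    rw [smul_smul, mul_assoc, mul_inv_cancel₀ hT.ne', mul_one]
  have hseg : ∀ t ∈ Icc 0 T, a + t • (T⁻¹ • (b - a)) ∈ U := by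
    intro t ht
    have : a + t • (T⁻¹ • (b - a)) = a + (t / T) • (b - a) := by
      rw [← hpt, div_mul_cancel₀ _ hT.ne']
    rw [this]
    exact hconv.add_smul_sub_mem ha hb ⟨div_nonneg ht.1 hT.le, (div_le_one hT).2 ht.2⟩
  have hc := semiconvex_of_isWeakSecondDeriv hU hf hfi hg1 hg2 hseg
  have h := hc.2 (left_mem_Icc.2 hT.le) (right_mem_Icc.2 hT.le) (sub_nonneg.2 hs.2) hs.1
    (sub_add_cancel 1 s)
  have h1 := hpt 1
  simp only [one_mul, one_smul, add_sub_cancel] at h1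
  simp only [smul_eq_mul, mul_zero, zero_add, zero_smul, add_zero, hpt, h1] at h
  nlinarith [h]

/-- The convexity defect bound on the interior extends to the whole convex body. -/
theorem le_combo_of_interior {Ω : Set (E d)} (hconv : Convex ℝ Ω) (hint : (interior Ω).Nonempty)
    {f : E d → ℝ} (hf : ContinuousOn f Ω) {K : ℝ}
    (h : ∀ a ∈ interior Ω, ∀ b ∈ interior Ω, ∀ s ∈ Icc (0 : ℝ) 1,
      f (a + s • (b - a)) ≤ (1 - s) * f a + s * f b + K / 2 * (s * (1 - s) * ‖b - a‖ ^ 2))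
    {a b : E d} (ha : a ∈ Ω) (hb : b ∈ Ω) {s : ℝ} (hs : s ∈ Icc (0 : ℝ) 1) :
    f (a + s • (b - a)) ≤ (1 - s) * f a + s * f b + K / 2 * (s * (1 - s) * ‖b - a‖ ^ 2) := by
  obtain ⟨c, hc⟩ := hint
  have hmem : ∀ x ∈ Ω, ∀ ε ∈ Ioc (0 : ℝ) 1, x + ε • (c - x) ∈ interior Ω :=
    fun x hx ε hε => hconv.add_smul_sub_mem_interior hx hc hε
  have hIoc : Ioc (0 : ℝ) 1 ∈ 𝓝[>] (0 : ℝ) := Ioc_mem_nhdsGT zero_lt_one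
  have hl : ∀ x : E d, Tendsto (fun ε : ℝ => x + ε • (c - x)) (𝓝[>] 0) (𝓝 x) := fun x => by
    have : Continuous fun ε : ℝ => x + ε • (c - x) := by fun_prop
    simpa using (this.tendsto 0).mono_left nhdsWithin_le_nhds
  have hlf : ∀ x ∈ Ω, Tendsto (fun ε : ℝ => f (x + ε • (c - x))) (𝓝[>] 0) (𝓝 (f x)) :=
    fun x hx => (hf x hx).tendsto.comp (tendsto_nhdsWithin_iff.2 ⟨hl x, by
      filter_upwards [hIoc] with ε hε using interior_subset (hmem x hx ε hε)⟩)
  have hm : a + s • (b - a) ∈ Ω := hconv.add_smul_sub_mem ha hb hs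
  refine le_of_tendsto_of_tendsto (hlf _ hm) ((((hlf a ha).const_mul _).add
    ((hlf b hb).const_mul _)).add (((((hl b).sub (hl a)).norm.pow 2).const_mul _).const_mul _)) ?_
  filter_upwards [hIoc] with ε hε
  have := h _ (hmem a ha ε hε) _ (hmem b hb ε hε) s hs
  have e : a + s • (b - a) + ε • (c - (a + s • (b - a))) =
      a + ε • (c - a) + s • (b + ε • (c - b) - (a + ε • (c - a))) := by module
  rw [e]
  exact this

/-- Tangent planes lie below `f + K ‖z - y‖ ^ 2 / 2`. -/
theorem fderivWithin_sub_le {Ω : Set (E d)} (hconv : Convex ℝ Ω) {f : E d → ℝ} {K : ℝ}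
    {y z : E d} (hy : y ∈ Ω) (hz : z ∈ Ω) (hf : DifferentiableWithinAt ℝ f Ω y)
    (h : ∀ s ∈ Icc (0 : ℝ) 1,
      f (y + s • (z - y)) ≤ (1 - s) * f y + s * f z + K / 2 * (s * (1 - s) * ‖z - y‖ ^ 2)) :
    fderivWithin ℝ f Ω y (z - y) ≤ f z - f y + K / 2 * ‖z - y‖ ^ 2 := by
  have h1 : HasDerivWithinAt (fun s : ℝ => y + s • (z - y)) (z - y) (Icc 0 1) 0 := by
    simpa using (((hasDerivAt_id (0 : ℝ)).smul_const (z - y)).const_add y).hasDerivWithinAt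
  have h2 : HasDerivWithinAt (fun s : ℝ => f (y + s • (z - y)))
      (fderivWithin ℝ f Ω y (z - y)) (Icc 0 1) 0 := by
    refine HasFDerivWithinAt.comp_hasDerivWithinAt (t := Ω) (0 : ℝ) ?_ h1 ?_
    · simpa using hf.hasFDerivWithinAt
    · exact fun s hs => hconv.add_smul_sub_mem hy hz hs
  have h3 : HasDerivWithinAt (fun s : ℝ => f (y + s • (z - y)))
      (fderivWithin ℝ f Ω y (z - y)) (Ioc 0 1) 0 := h2.mono Ioc_subset_Icc_self
  rw [hasDerivWithinAt_iff_tendsto_slope' (by simp)] at h3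
  have h4 : Tendsto (fun s : ℝ => f z - f y + K / 2 * ((1 - s) * ‖z - y‖ ^ 2)) (𝓝[Ioc 0 1] 0)
      (𝓝 (f z - f y + K / 2 * ‖z - y‖ ^ 2)) := by
    have : Continuous fun s : ℝ => f z - f y + K / 2 * ((1 - s) * ‖z - y‖ ^ 2) := by fun_prop
    simpa using (this.tendsto 0).mono_left nhdsWithin_le_nhds
  have : (𝓝[Ioc (0 : ℝ) 1] 0).NeBot := by
    rw [← mem_closure_iff_nhdsWithin_neBot, closure_Ioc zero_ne_one]; simp
  refine le_of_tendsto_of_tendsto h3 h4 ?_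
  filter_upwards [self_mem_nhdsWithin] with s hs
  have := h s ⟨hs.1.le, hs.2⟩
  rw [slope_def_field, sub_zero, zero_smul, add_zero, div_le_iff₀ hs.1]
  linarith

/-- For `w` in the class, the weak second derivatives are bounded pointwise a.e. once `w` is. -/
theorem exists_weakSecondDeriv_bound {q M : ℝ} {Ω : Set (E d)} (hΩ : IsClosed Ω) {w : E d → ℝ}
    (hw : w ∈ W 0 q Ω) (hM : ∀ x ∈ Ω, |w x| ≤ M) {u : E d} (hu : ‖u‖ = 1) :
    ∃ g, IsWeakSecondDeriv (interior Ω) w u g ∧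
      ∀ᵐ x ∂volume.restrict (interior Ω), |g x| ≤ 1 + |q| * M := by
  obtain ⟨g, hg, hb⟩ := hw.2 u hu
  refine ⟨g, hg, ae_restrict_of_ae_restrict_of_subset interior_subset ?_⟩
  rw [eLpNorm_exponent_top] at hb
  filter_upwards [enorm_ae_le_eLpNormEssSup
    (fun x => g x + 0 * fderivWithin ℝ w Ω x u + q * w x) (volume.restrict Ω),
    ae_restrict_mem hΩ.measurableSet] with x hx hxΩ
  have h1 : ‖g x + q * w x‖ₑ ≤ 1 := by simpa using hx.trans hb
  have h2 : |g x + q * w x| ≤ 1 := by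
    rw [← ofReal_norm, ENNReal.ofReal_le_one] at h1
    exact h1
  calc |g x| = |(g x + q * w x) - q * w x| := by ring_nf
    _ ≤ |g x + q * w x| + |q * w x| := abs_sub _ _
    _ ≤ 1 + |q| * M := by
      rw [abs_mul]; gcongr; exact hM x hxΩ

/-- Taylor's inequality with remainder `K ‖z - y‖ ^ 2 / 2`, `K = 1 + |q| M`, for members of the
class bounded by `M`. It holds up to the boundary of the convex body. -/
theorem taylor_of_mem_W {q M : ℝ} {Ω : Set (E d)} (hconv : Convex ℝ Ω) (hcomp : IsCompact Ω)
    (hint : (interior Ω).Nonempty) {w : E d → ℝ} (hw : w ∈ W 0 q Ω) (hM : ∀ x ∈ Ω, |w x| ≤ M)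
    {y z : E d} (hy : y ∈ Ω) (hz : z ∈ Ω) :
    |w z - w y - fderivWithin ℝ w Ω y (z - y)| ≤ (1 + |q| * M) / 2 * ‖z - y‖ ^ 2 := by
  have hcont : ContinuousOn w Ω := hw.1.continuousOn
  have hdiff : DifferentiableWithinAt ℝ w Ω y := hw.1.differentiableOn one_ne_zero y hy
  have hi : IntegrableOn w (interior Ω) volume :=
    (hcont.integrableOn_compact hcomp).mono_set interior_subset
  have h1 := fderivWithin_sub_le hconv (K := 1 + |q| * M) hy hz hdiff fun s hs =>
    le_combo_of_interior hconv hint hcont (fun a ha b hb s hs =>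
      le_combo_of_isWeakSecondDeriv isOpen_interior hconv.interior
        (hcont.mono interior_subset) hi (fun u hu => by
          obtain ⟨g, hg, hb⟩ := exists_weakSecondDeriv_bound hcomp.isClosed hw hM hu
          exact ⟨g, hg, hb.mono fun x hx => (abs_le.1 hx).1⟩) ha hb hs) hy hz hs
  have h2 := fderivWithin_sub_le hconv (f := -w) (K := 1 + |q| * M) hy hz hdiff.neg fun s hs =>
    le_combo_of_interior hconv hint hcont.neg (fun a ha b hb s hs =>
      le_combo_of_isWeakSecondDeriv isOpen_interior hconv.interior
        (hcont.neg.mono interior_subset) hi.neg (fun u hu => by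
          obtain ⟨g, hg, hb⟩ := exists_weakSecondDeriv_bound hcomp.isClosed hw hM hu
          exact ⟨-g, hg.neg, hb.mono fun x hx => neg_le_neg (abs_le.1 hx).2⟩) ha hb hs) hy hz hs
  have h3 : fderivWithin ℝ (-w) Ω y = -fderivWithin ℝ w Ω y := by
    exact fderivWithin_neg (uniqueDiffWithinAt_convex hconv hint (subset_closure hy))
  rw [h3] at h2
  simp only [Pi.neg_apply, neg_apply] at h2
  rw [abs_le]
  constructor <;> linarith

/-! ### Nodes that surround a point -/

open scoped InnerProductSpace in
/-- If the closed balls of radius `h` around the nodes cover `closedBall y h`, then `y` is a convex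
combination of nodes whose mean square distance to `y` is at most `h ^ 2`. This plays the role of a
Delaunay simplex containing `y`. -/
theorem exists_weights_of_covering {X : Finset (E d)} {y : E d} {h : ℝ} (hh : 0 < h)
    (hcov : ∀ c ∈ Metric.closedBall y h, ∃ x ∈ X, dist x c ≤ h) :
    ∃ l : E d → ℝ, (∀ x ∈ X, 0 ≤ l x) ∧ ∑ x ∈ X, l x = 1 ∧ ∑ x ∈ X, l x • (x - y) = 0 ∧
      ∑ x ∈ X, l x * ‖x - y‖ ^ 2 ≤ h ^ 2 := by
  classical
  let p : E d → E d × ℝ := fun x => (x - y, ‖x - y‖ ^ 2)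
  have hp : Function.Injective p := fun x x' hx => by simpa [p] using congrArg Prod.fst hx
  set S : Set (E d × ℝ) := convexHull ℝ ((X.image p : Finset (E d × ℝ)) : Set (E d × ℝ)) with hS
  set R : Set (E d × ℝ) := {0} ×ˢ Iic (h ^ 2) with hR
  by_cases hdisj : Disjoint S R
  · exfalso
    obtain ⟨f, u, v, hu, huv, hv⟩ := geometric_hahn_banach_compact_closed (convex_convexHull ℝ _)
      ((X.image p).finite_toSet.isCompact_convexHull ℝ)
      ((convex_singleton (0 : E d)).prod (convex_Iic (𝕜 := ℝ) (h ^ 2)))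
      (isClosed_singleton.prod isClosed_Iic) hdisj
    set a : E d := (InnerProductSpace.toDual ℝ (E d)).symm
      (f.comp (ContinuousLinearMap.inl ℝ (E d) ℝ)) with ha
    set β : ℝ := f (0, 1) with hβ
    have hf : ∀ (w : E d) (t : ℝ), f (w, t) = ⟪a, w⟫_ℝ + β * t := fun w t => by
      have h1 : ((w, t) : E d × ℝ) = (w, 0) + t • (0, 1) := by simp
      rw [h1, map_add, map_smul, ha, InnerProductSpace.toDual_symm_apply, smul_eq_mul, mul_comm]
      simp [hβ]
    -- The functional is bounded below on the downward ray `R`.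
    have hβ0 : β ≤ 0 := by
      by_contra! hpos
      have h1 := hv (0, min (h ^ 2) ((v - 1) / β)) (by simp)
      rw [hf, inner_zero_right, zero_add] at h1
      have h2 : β * min (h ^ 2) ((v - 1) / β) ≤ v - 1 := by
        rw [← le_div_iff₀' hpos]; exact min_le_right _ _
      linarith
    have hnode : ∀ x ∈ X, ⟪a, x - y⟫_ℝ + β * ‖x - y‖ ^ 2 < β * h ^ 2 := fun x hx => by
      have h1 := hu (p x) (subset_convexHull ℝ _ (by
        exact_mod_cast Finset.mem_image_of_mem p hx))
      have h2 := hv (0, h ^ 2) (by simp)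
      rw [hf] at h1 h2
      rw [inner_zero_right, zero_add] at h2
      linarith
    -- A node within `h` of `y + τ a` refutes the separation: `τ = 1 / (2 |β|)` completes the
    -- square, and if that leaves the `h`-ball around `y`, then `τ = h / ‖a‖` does.
    have key : ∀ τ : ℝ, 0 ≤ τ → τ * ‖a‖ ≤ h → ∃ x ∈ X,
        ‖x - y‖ ^ 2 - 2 * τ * ⟪a, x - y⟫_ℝ + (τ * ‖a‖) ^ 2 ≤ h ^ 2 := by
      intro τ hτ hτa
      obtain ⟨x, hx, hxd⟩ := hcov (y + τ • a) (by
        rw [Metric.mem_closedBall, dist_eq_norm, add_sub_cancel_left, norm_smul,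
          Real.norm_of_nonneg hτ]; exact hτa)
      refine ⟨x, hx, ?_⟩
      rw [dist_eq_norm, ← sub_sub] at hxd
      have h1 : ‖x - y - τ • a‖ ^ 2 ≤ h ^ 2 := by gcongr
      rw [norm_sub_sq_real, inner_smul_right, norm_smul, Real.norm_of_nonneg hτ,
        real_inner_comm] at h1
      linarith
    rcases le_or_gt ‖a‖ (2 * -β * h) with hle | hgt
    · rcases hβ0.eq_or_lt with h0 | hneg
      · have ha0 : a = 0 := by
          rw [h0] at hle; simpa using hle
        obtain ⟨x, hx, -⟩ := key 0 le_rfl (by simpa using hh.le)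
        have := hnode x hx
        rw [ha0, h0] at this
        simp at this
      · have hτ : 0 < 2 * -β := by linarith
        obtain ⟨x, hx, hx2⟩ := key (2 * -β)⁻¹ (by positivity) (by
          rw [inv_mul_le_iff₀ hτ]; exact hle)
        have h1 := hnode x hx
        have h2 : 2 * (2 * -β)⁻¹ * -β = 1 := by
          have := hneg.ne
          field_simp
        have h3 := mul_le_mul_of_nonneg_left hx2 (neg_nonneg.2 hβ0)
        have h4 : -β * (‖x - y‖ ^ 2 - 2 * (2 * -β)⁻¹ * ⟪a, x - y⟫_ℝ + ((2 * -β)⁻¹ * ‖a‖) ^ 2) =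
          -β * ‖x - y‖ ^ 2 - ⟪a, x - y⟫_ℝ + -β * ((2 * -β)⁻¹ * ‖a‖) ^ 2 := by
          linear_combination (-⟪a, x - y⟫_ℝ) * h2
        have h5 : 0 ≤ -β * ((2 * -β)⁻¹ * ‖a‖) ^ 2 :=
          mul_nonneg (neg_nonneg.2 hβ0) (sq_nonneg _)
        linarith
    · have hapos : 0 < ‖a‖ := lt_of_le_of_lt (by nlinarith) hgt
      have hτ : 0 < h / ‖a‖ := by positivity
      have hτa : h / ‖a‖ * ‖a‖ = h := div_mul_cancel₀ _ hapos.ne'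
      obtain ⟨x, hx, hx2⟩ := key (h / ‖a‖) hτ.le hτa.le
      have h1 := hnode x hx
      rw [hτa] at hx2
      have h2 : 2 * -β * (h / ‖a‖) ≤ 1 := by
        rw [← mul_div_assoc, div_le_one hapos]; exact hgt.le
      have h3 : 0 ≤ ⟪a, x - y⟫_ℝ := by
        have : 0 ≤ (h / ‖a‖) * ⟪a, x - y⟫_ℝ := by nlinarith [sq_nonneg ‖x - y‖]
        exact nonneg_of_mul_nonneg_right this hτ
      have h4 := mul_le_mul_of_nonneg_right h2 h3
      have h5 : -β * ‖x - y‖ ^ 2 ≤ -β * (2 * (h / ‖a‖) * ⟪a, x - y⟫_ℝ) :=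
        mul_le_mul_of_nonneg_left (by linarith) (neg_nonneg.2 hβ0)
      have h6 : 0 ≤ -β * h ^ 2 := mul_nonneg (neg_nonneg.2 hβ0) (sq_nonneg _)
      linarith
  · obtain ⟨⟨w, t⟩, hwS, hwR⟩ := not_disjoint_iff.1 hdisj
    rw [hS, Finset.mem_convexHull'] at hwS
    obtain ⟨l, hl0, hl1, hl2⟩ := hwS
    simp only [hR, mem_prod, mem_singleton_iff, mem_Iic] at hwR
    rw [Finset.sum_image hp.injOn] at hl1 hl2
    refine ⟨fun x => l (p x), fun x hx => hl0 _ (Finset.mem_image_of_mem p hx), hl1, ?_, ?_⟩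
    · have := congrArg Prod.fst hl2
      simpa [Prod.fst_sum, p, hwR.1] using this
    · have := congrArg Prod.snd hl2
      simp only [Prod.snd_sum, p, Prod.smul_snd, smul_eq_mul] at this
      rw [this]; exact hwR.2

/-- A member of the class that vanishes together with its gradient at the nodes is small at every
point that is a convex combination of nodes with small mean square distance. -/
theorem abs_le_of_weights {q M : ℝ} {Ω : Set (E d)} (hconv : Convex ℝ Ω) (hcomp : IsCompact Ω)
    (hint : (interior Ω).Nonempty) {w : E d → ℝ} (hw : w ∈ W 0 q Ω) (hM : ∀ x ∈ Ω, |w x| ≤ M)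
    (hM0 : 0 ≤ M)
    {X : Finset (E d)} (hX : ∀ x ∈ X, x ∈ Ω ∧ w x = 0 ∧ fderivWithin ℝ w Ω x = 0)
    {y : E d} (hy : y ∈ Ω) {l : E d → ℝ} {s : ℝ} (hl : ∀ x ∈ X, 0 ≤ l x)
    (hl1 : ∑ x ∈ X, l x = 1) (hl2 : ∑ x ∈ X, l x • (x - y) = 0)
    (hl3 : ∑ x ∈ X, l x * ‖x - y‖ ^ 2 ≤ s) :
    |w y| ≤ (1 + |q| * M) / 4 * s := by
  set K := 1 + |q| * M with hK
  set D := fderivWithin ℝ w Ω y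
  -- Taylor's inequality at the midpoint of `x` and `y`, expanded from `x` and from `y`.
  have hterm : ∀ x ∈ X, |w y + 1 / 2 * D (x - y)| ≤ K / 4 * ‖x - y‖ ^ 2 := by
    intro x hx
    obtain ⟨hxΩ, hx0, hx1⟩ := hX x hx
    have hz : y + (1 / 2 : ℝ) • (x - y) ∈ Ω :=
      hconv.add_smul_sub_mem hy hxΩ (by constructor <;> norm_num)
    have h1 := taylor_of_mem_W hconv hcomp hint hw hM hxΩ hz
    have h2 : |w (y + (1 / 2 : ℝ) • (x - y)) - w y - D (y + (1 / 2 : ℝ) • (x - y) - y)| ≤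
      K / 2 * ‖y + (1 / 2 : ℝ) • (x - y) - y‖ ^ 2 := taylor_of_mem_W hconv hcomp hint hw hM hy hz
    rw [← hK] at h1
    have e1 : y + (1 / 2 : ℝ) • (x - y) - x = (-1 / 2 : ℝ) • (x - y) := by module
    rw [hx0, hx1, e1, norm_smul] at h1
    rw [add_sub_cancel_left, norm_smul, map_smul] at h2
    norm_num [mul_pow] at h1 h2
    rw [map_sub]
    rw [abs_le] at h1 h2 ⊢
    constructor <;> linarith
  have hsum : w y = ∑ x ∈ X, l x * (w y + 1 / 2 * D (x - y)) := by
    have h1 : ∑ x ∈ X, l x * D (x - y) = 0 := by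
      have := congrArg D hl2
      simpa [map_sum] using this
    have h2 : ∀ x, l x * (w y + 1 / 2 * D (x - y)) = l x * w y + 1 / 2 * (l x * D (x - y)) :=
      fun x => by ring
    simp_rw [h2]
    rw [Finset.sum_add_distrib, ← Finset.sum_mul, hl1, ← Finset.mul_sum, h1]
    ring
  calc |w y| = |∑ x ∈ X, l x * (w y + 1 / 2 * D (x - y))| := by rw [← hsum]
    _ ≤ ∑ x ∈ X, |l x * (w y + 1 / 2 * D (x - y))| := Finset.abs_sum_le_sum_abs _ _
    _ ≤ ∑ x ∈ X, K / 4 * (l x * ‖x - y‖ ^ 2) := by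
      refine Finset.sum_le_sum fun x hx => ?_
      rw [abs_mul, abs_of_nonneg (hl x hx)]
      calc _ ≤ l x * (K / 4 * ‖x - y‖ ^ 2) := mul_le_mul_of_nonneg_left (hterm x hx) (hl x hx)
        _ = _ := by ring
    _ ≤ K / 4 * s := by
      rw [← Finset.mul_sum]
      exact mul_le_mul_of_nonneg_left hl3 (by positivity)

/-- Members of the class with a common bound are equi-Lipschitz. -/
theorem exists_lipschitz_bound {q M : ℝ} {Ω : Set (E d)} (hconv : Convex ℝ Ω)
    (hcomp : IsCompact Ω) (hint : (interior Ω).Nonempty) (hM0 : 0 ≤ M) :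
    ∃ C : ℝ, 0 ≤ C ∧ ∀ w ∈ W 0 q Ω, (∀ x ∈ Ω, |w x| ≤ M) →
      ∀ y ∈ Ω, ∀ z ∈ Ω, |w z - w y| ≤ C * ‖z - y‖ := by
  obtain ⟨c, hc⟩ := hint
  obtain ⟨r, hr, hball⟩ := Metric.nhds_basis_closedBall.mem_iff.1 (mem_interior_iff_mem_nhds.1 hc)
  obtain ⟨D, hD⟩ := Metric.isBounded_iff.1 hcomp.isBounded
  have hcΩ : c ∈ Ω := interior_subset hc
  have hD0 : 0 ≤ D := dist_nonneg.trans (hD hcΩ hcΩ)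
  set K := 1 + |q| * M with hK
  have hK0 : 0 ≤ K := by positivity
  set B := 2 * M + K / 2 * D ^ 2 with hB
  have hB0 : 0 ≤ B := by positivity
  refine ⟨2 * B / r + K / 2 * D, by positivity, fun w hw hM y hy z hz => ?_⟩
  have hT := fun z hz => taylor_of_mem_W (z := z) hconv hcomp ⟨c, hc⟩ hw hM hy hz
  have hdist : ∀ z ∈ Ω, ‖z - y‖ ≤ D := fun z hz => by
    rw [← dist_eq_norm]; exact hD hz hy
  set L := fderivWithin ℝ w Ω y
  have hL : ∀ z ∈ Ω, |L (z - y)| ≤ B := fun z hz => by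
    have h1 := hT z hz
    have h2 : K / 2 * ‖z - y‖ ^ 2 ≤ K / 2 * D ^ 2 := by
      gcongr; exact hdist z hz
    have h3 := hM z hz
    have h4 := hM y hy
    rw [abs_le] at *
    constructor <;> linarith
  -- The ball around `c` inside `Ω` makes the bound `hL` control the derivative in all directions.
  have hL2 : ∀ v : E d, ‖v‖ ≤ r → |L v| ≤ 2 * B := fun v hv => by
    have h1 := hL (c + v) (hball (by simpa [dist_eq_norm] using hv))
    have h2 := hL c hcΩ
    have e : L v = L (c + v - y) - L (c - y) := by rw [← map_sub]; congr 1; abel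
    rw [e]
    exact (abs_sub _ _).trans (by linarith)
  have hL3 : |L (z - y)| ≤ 2 * B / r * ‖z - y‖ := by
    rcases eq_or_ne z y with rfl | hne
    · simp
    have hpos : 0 < ‖z - y‖ := norm_pos_iff.2 (sub_ne_zero.2 hne)
    have h1 := hL2 ((r / ‖z - y‖) • (z - y)) (by
      rw [norm_smul, Real.norm_of_nonneg (by positivity), div_mul_cancel₀ _ hpos.ne'])
    rw [map_smul, smul_eq_mul, abs_mul, abs_of_nonneg (by positivity)] at h1
    rw [div_mul_eq_mul_div, le_div_iff₀ hr]
    calc |L (z - y)| * r = (r / ‖z - y‖ * |L (z - y)|) * ‖z - y‖ := by field_simp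
      _ ≤ _ := by gcongr
  have h1 := hT z hz
  have h2 : K / 2 * ‖z - y‖ ^ 2 ≤ K / 2 * D * ‖z - y‖ := by
    rw [sq, ← mul_assoc]; gcongr; exact hdist z hz
  rw [add_mul]
  rw [abs_le] at *
  constructor <;> linarith

/-! ### Upper bound for the optimal error -/

theorem integrableOn_mul_fderiv_fderiv {U : Set (E d)} (hU : MeasurableSet U) {f φ : E d → ℝ}
    (hf : LocallyIntegrableOn f U volume) (hφ : ContDiff ℝ ∞ φ) (hc : HasCompactSupport φ)
    (hs : tsupport φ ⊆ U) (u : E d) :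
    IntegrableOn (fun x => f x * fderiv ℝ (fun y => fderiv ℝ φ y u) x u) U volume := by
  have h1 : ContDiff ℝ 1 (fun z => fderiv ℝ φ z u) :=
    ((contDiff_infty.1 hφ 2).fderiv_right (m := 1) (by norm_num)).clm_apply contDiff_const
  have h2 : Continuous fun x => fderiv ℝ (fun y => fderiv ℝ φ y u) x u :=
    (h1.continuous_fderiv one_ne_zero).clm_apply continuous_const
  have hsub : ∀ {g : E d → ℝ}, tsupport (fun x => fderiv ℝ g x u) ⊆ tsupport g := fun {g} => by
    refine closure_minimal (fun x hx => ?_) (isClosed_tsupport _)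
    by_contra hx'
    refine hx ?_
    have : x ∉ tsupport (fderiv ℝ g) := fun h => hx' (tsupport_fderiv_subset ℝ h)
    simp [image_eq_zero_of_notMem_tsupport this]
  have h3 := (hsub (g := fun y => fderiv ℝ φ y u)).trans (hsub (g := φ))
  exact integrableOn_mul_of_hasCompactSupport hU hf h2
    (hc.of_isClosed_subset (isClosed_tsupport _) h3) (h3.trans hs)

/-- Half the difference of two members of the class belongs to the class. -/
theorem half_sub_mem_W {q : ℝ} {Ω : Set (E d)} (hcomp : IsCompact Ω) {f g : E d → ℝ}
    (hf : f ∈ W 0 q Ω) (hg : g ∈ W 0 q Ω) : (fun x => (f x - g x) / 2) ∈ W 0 q Ω := by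
  refine ⟨(hf.1.sub hg.1).div_const 2, fun u hu => ?_⟩
  obtain ⟨a, ⟨ha1, ha2⟩, ha3⟩ := hf.2 u hu
  obtain ⟨b, ⟨hb1, hb2⟩, hb3⟩ := hg.2 u hu
  have hloc : ∀ {k : E d → ℝ}, k ∈ W 0 q Ω → LocallyIntegrableOn k (interior Ω) volume :=
    fun hk => ((hk.1.continuousOn.integrableOn_compact hcomp).mono_set
      interior_subset).locallyIntegrableOn
  have hU : MeasurableSet (interior Ω) := isOpen_interior.measurableSet
  refine ⟨fun x => 2⁻¹ * (a x - b x), ⟨?_, fun φ h1 h2 h3 => ?_⟩, ?_⟩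
  · exact (ha1.sub hb1).smul (2⁻¹ : ℝ)
  · have e1 : ∀ x, (f x - g x) / 2 * fderiv ℝ (fun y => fderiv ℝ φ y u) x u =
        2⁻¹ * (f x * fderiv ℝ (fun y => fderiv ℝ φ y u) x u -
          g x * fderiv ℝ (fun y => fderiv ℝ φ y u) x u) := fun x => by ring
    have e2 : ∀ x, 2⁻¹ * (a x - b x) * φ x = 2⁻¹ * (a x * φ x - b x * φ x) := fun x => by ring
    simp_rw [e1, e2]
    rw [integral_const_mul, integral_const_mul,
      integral_sub (integrableOn_mul_fderiv_fderiv hU (hloc hf) h1 h2 h3 u)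
        (integrableOn_mul_fderiv_fderiv hU (hloc hg) h1 h2 h3 u),
      integral_sub (integrableOn_mul_of_hasCompactSupport hU ha1 h1.continuous h2 h3)
        (integrableOn_mul_of_hasCompactSupport hU hb1 h1.continuous h2 h3),
      ha2 φ h1 h2 h3, hb2 φ h1 h2 h3]
  · rw [eLpNorm_exponent_top] at *
    refine essSup_le_of_ae_le _ ?_
    filter_upwards [enorm_ae_le_eLpNormEssSup
        (fun x => a x + 0 * fderivWithin ℝ f Ω x u + q * f x) (volume.restrict Ω),
      enorm_ae_le_eLpNormEssSup
        (fun x => b x + 0 * fderivWithin ℝ g Ω x u + q * g x) (volume.restrict Ω)] with x hx1 hx2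
    replace hx1 := hx1.trans ha3
    replace hx2 := hx2.trans hb3
    simp only [zero_mul, add_zero] at hx1 hx2 ⊢
    rw [← ofReal_norm, ENNReal.ofReal_le_one, Real.norm_eq_abs, abs_le] at *
    constructor <;> linarith [hx1.1, hx1.2, hx2.1, hx2.2]

/-- If members of the class with zero data are bounded by `e`, then the data determine a member
of the class up to `e`: the algorithm sends the data to the upper envelope of all members with
these data, lowered by `e`. -/
theorem optimalError_le_of_zero_data {q e : ℝ} {Ω : Set (E d)} (hconv : Convex ℝ Ω)
    (hcomp : IsCompact Ω) (hint : (interior Ω).Nonempty) (he : 0 ≤ e) {ξ : Finset (E d)}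
    (hξ : (ξ : Set (E d)) ⊆ Ω)
    (hzero : ∀ w ∈ W 0 q Ω, (∀ x ∈ ξ, w x = 0 ∧ fderivWithin ℝ w Ω x = 0) →
      ∀ y ∈ Ω, |w y| ≤ e) :
    optimalError Ω (W 0 q Ω) ξ ≤ ENNReal.ofReal e := by
  obtain ⟨C, hC0, hC⟩ := exists_lipschitz_bound (q := q) hconv hcomp hint he
  have hpair : ∀ f ∈ W 0 q Ω, ∀ g ∈ W 0 q Ω, info Ω ξ f = info Ω ξ g →
      (∀ y ∈ Ω, |f y - g y| ≤ 2 * e) ∧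
        ∀ y ∈ Ω, ∀ z ∈ Ω, |(f z - g z) - (f y - g y)| ≤ 2 * C * ‖z - y‖ := by
    intro f hf g hg hfg
    have hw := half_sub_mem_W hcomp hf hg
    have hz := hzero _ hw fun x hx => by
      have h1 := congrFun hfg ⟨x, hx⟩
      simp only [info, Prod.mk.injEq, gradientWithin] at h1
      have h2 := (InnerProductSpace.toDual ℝ (E d)).symm.injective h1.2
      have hu := uniqueDiffWithinAt_convex hconv hint (subset_closure (hξ hx))
      have hdf := hf.1.differentiableOn one_ne_zero x (hξ hx)
      have hdg := hg.1.differentiableOn one_ne_zero x (hξ hx)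
      refine ⟨by simp [h1.1], ?_⟩
      have h3 := ((hdf.hasFDerivWithinAt.sub hdg.hasFDerivWithinAt).const_mul
        (2⁻¹ : ℝ)).fderivWithin hu
      rw [h2, sub_self, smul_zero] at h3
      rw [show (fun x => (f x - g x) / 2) = fun x => 2⁻¹ * (f x - g x) from
        funext fun _ => div_eq_inv_mul _ _]
      exact h3
    refine ⟨fun y hy => ?_, fun y hy z hz' => ?_⟩
    · have := hz y hy
      rw [abs_div, abs_two] at this
      linarith
    · have := hC _ hw hz y hy z hz'
      rw [← sub_div, abs_div, abs_two] at this
      linarith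
  have hex : ∀ I : ξ → ℝ × E d, ∃ m : C(Ω, ℝ), ∀ f ∈ W 0 q Ω, info Ω ξ f = I →
      ∀ x : Ω, |f x - m x| ≤ e := by
    intro I
    by_cases hI : ∃ f₀ ∈ W 0 q Ω, info Ω ξ f₀ = I
    · obtain ⟨f₀, hf₀, rfl⟩ := hI
      let A := {f : E d → ℝ // f ∈ W 0 q Ω ∧ info Ω ξ f = info Ω ξ f₀}
      have : Nonempty A := ⟨⟨f₀, hf₀, rfl⟩⟩
      let s : Ω → ℝ := fun x => ⨆ f : A, (f.1 x - f₀ x)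
      have hbdd : ∀ x : Ω, BddAbove (range fun f : A => f.1 x - f₀ x) := fun x =>
        ⟨2 * e, by
          rintro _ ⟨f, rfl⟩
          exact (le_abs_self _).trans ((hpair f.1 f.2.1 f₀ hf₀ f.2.2).1 x x.2)⟩
      have hs : LipschitzWith (2 * C).toNNReal s := by
        refine LipschitzWith.of_le_add_mul _ fun x y => ciSup_le fun f => ?_
        have h1 := (hpair f.1 f.2.1 f₀ hf₀ f.2.2).2 y y.2 x x.2
        have h2 := le_ciSup (hbdd y) f
        rw [Real.coe_toNNReal _ (by positivity), Subtype.dist_eq, dist_eq_norm]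
        have h3 := (le_abs_self _).trans h1
        simp only [s]
        linarith
      have hc : Continuous fun x : Ω => f₀ x + s x - e :=
        ((continuousOn_iff_continuous_domRestrict.1 hf₀.1.continuousOn).add
          hs.continuous).sub continuous_const
      refine ⟨⟨_, hc⟩, fun f hf hfI x => ?_⟩
      · have h1 : f x - f₀ x ≤ s x := le_ciSup (hbdd x) (⟨f, hf, hfI⟩ : A)
        have h2 : s x ≤ f x - f₀ x + 2 * e := ciSup_le fun k => by
          have := (le_abs_self _).trans
            ((hpair k.1 k.2.1 f hf (k.2.2.trans hfI.symm)).1 x x.2)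
          linarith
        rw [abs_le]
        change -e ≤ f x - (f₀ x + s x - e) ∧ f x - (f₀ x + s x - e) ≤ e
        constructor <;> linarith
    · exact ⟨0, fun f hf hfI => absurd ⟨f, hf, hfI⟩ hI⟩
  choose φ hφ using hex
  refine iInf_le_of_le φ (iSup₂_le fun f hf => ?_)
  rw [eLpNorm_exponent_top]
  exact eLpNormEssSup_le_of_ae_bound (Eventually.of_forall fun x => hφ _ f hf rfl x)

/-- Recovery error for nodes `ξ` such that each point of the body either is very close to a node
or has a neighbourhood of radius `h` that is covered by the `h`-balls around the nodes. -/
theorem optimalError_le_of_covering {q h : ℝ} {Ω : Set (E d)} (hconv : Convex ℝ Ω)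
    (hcomp : IsCompact Ω) (hint : (interior Ω).Nonempty) (hh : 0 < h) (hqh : |q| * h ^ 2 < 4)
    {ξ : Finset (E d)} (hξ : (ξ : Set (E d)) ⊆ Ω)
    (hcov : ∀ y ∈ Ω, (∃ x ∈ ξ, dist x y ≤ h / 2) ∨
      ∀ c ∈ Metric.closedBall y h, ∃ x ∈ ξ, dist x c ≤ h) :
    optimalError Ω (W 0 q Ω) ξ ≤ ENNReal.ofReal (h ^ 2 / 4 / (1 - |q| * h ^ 2 / 4)) := by
  have hpos : 0 < 1 - |q| * h ^ 2 / 4 := by linarith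
  refine optimalError_le_of_zero_data hconv hcomp hint (by positivity) hξ fun w hw hw0 => ?_
  obtain ⟨x₀, hx₀, hmax⟩ := hcomp.exists_isMaxOn (hint.mono interior_subset)
    hw.1.continuousOn.abs
  set M := |w x₀| with hMdef
  have hM : ∀ x ∈ Ω, |w x| ≤ M := hmax
  have hM0 : 0 ≤ M := abs_nonneg _
  have hstep : ∀ y ∈ Ω, |w y| ≤ (1 + |q| * M) / 4 * h ^ 2 := by
    intro y hy
    rcases hcov y hy with ⟨x, hx, hxy⟩ | hc
    · have h1 := taylor_of_mem_W hconv hcomp hint hw hM (hξ hx) hy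
      rw [(hw0 x hx).1, (hw0 x hx).2] at h1
      simp only [sub_zero, zero_apply] at h1
      rw [dist_comm, dist_eq_norm] at hxy
      have h2 : ‖y - x‖ ^ 2 ≤ (h / 2) ^ 2 := by gcongr
      have h3 : 0 ≤ (1 + |q| * M) / 2 := by positivity
      nlinarith [mul_le_mul_of_nonneg_left h2 h3, mul_nonneg h3 (sq_nonneg h)]
    · obtain ⟨l, hl0, hl1, hl2, hl3⟩ := exists_weights_of_covering hh hc
      exact abs_le_of_weights hconv hcomp hint hw hM hM0
        (fun x hx => ⟨hξ hx, hw0 x hx⟩) hy hl0 hl1 hl2 hl3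
  have h1 := hstep x₀ hx₀
  intro y hy
  refine (hM y hy).trans ?_
  rw [le_div_iff₀ hpos]
  linarith

/-! ### Lower bound for the optimal error -/

/-- A compactly supported `C¹` function whose derivative is `c`-Lipschitz and which is bounded by
`m` belongs to the class as soon as `c + |q| m ≤ 1`. -/
theorem mem_W_of_lipschitz_fderiv {q m : ℝ} {c : NNReal} {Ω : Set (E d)} {F : E d → ℝ}
    (hF : ContDiff ℝ 1 F) (hFc : HasCompactSupport F) (hlip : LipschitzWith c (fderiv ℝ F))
    (hm : ∀ x, |F x| ≤ m) (hcm : c + |q| * m ≤ 1) : F ∈ W 0 q Ω := by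
  refine ⟨hF.contDiffOn, fun u hu => ?_⟩
  set G : E d → ℝ := fun x => fderiv ℝ F x u with hG
  have hGlip : LipschitzWith c G := by
    refine LipschitzWith.of_dist_le_mul fun x y => ?_
    have h1 := hlip.dist_le_mul x y
    rw [dist_eq_norm] at h1 ⊢
    have h2 := (fderiv ℝ F x - fderiv ℝ F y).le_opNorm u
    rw [hu, mul_one] at h2
    exact h2.trans h1
  obtain ⟨C, hFlip⟩ := hF.lipschitzWith_of_hasCompactSupport hFc one_ne_zero
  have hbd : ∀ x, ‖lineDeriv ℝ G x u‖ ≤ c := fun x => by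
    have := norm_lineDeriv_le_of_lipschitz ℝ hGlip (x₀ := x) (v := u)
    rwa [hu, mul_one] at this
  refine ⟨fun x => lineDeriv ℝ G x u,
    ⟨(hGlip.locallyIntegrable_lineDeriv u).locallyIntegrableOn _, fun φ h1 h2 h3 => ?_⟩, ?_⟩
  · have hφ1 : ContDiff ℝ 1 (fun z => fderiv ℝ φ z u) :=
      ((contDiff_infty.1 h1 2).fderiv_right (m := 1) (by norm_num)).clm_apply contDiff_const
    have hφc : HasCompactSupport (fun z => fderiv ℝ φ z u) :=
      (h2.fderiv ℝ).comp_left (g := fun L : E d →L[ℝ] ℝ => L u) (by simp)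
    obtain ⟨C1, hφlip⟩ := h1.lipschitzWith_of_hasCompactSupport h2 (by simp)
    obtain ⟨C2, hφ1lip⟩ := hφ1.lipschitzWith_of_hasCompactSupport hφc one_ne_zero
    have e1 := hFlip.integral_lineDeriv_mul_eq (μ := volume) hφ1lip hφc u
    have e2 := hGlip.integral_lineDeriv_mul_eq (μ := volume) hφlip h2 u
    simp_rw [(hF.differentiable one_ne_zero).differentiableAt.lineDeriv_eq_fderiv,
      (hφ1.differentiable one_ne_zero).differentiableAt.lineDeriv_eq_fderiv] at e1
    simp_rw [(h1.differentiable (by simp)).differentiableAt.lineDeriv_eq_fderiv] at e2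
    simp only [map_neg, neg_mul, integral_neg] at e1 e2
    have hz : ∀ x ∉ interior Ω, φ x = 0 := fun x hx =>
      image_eq_zero_of_notMem_tsupport fun h => hx (h3 h)
    have hsub : ∀ {g : E d → ℝ}, ∀ x ∉ tsupport g, fderiv ℝ g x u = 0 := fun {g} x hx => by
      rw [image_eq_zero_of_notMem_tsupport fun h => hx (tsupport_fderiv_subset ℝ h)]; rfl
    have hsub' : tsupport (fun y => fderiv ℝ φ y u) ⊆ tsupport φ :=
      closure_minimal (fun x hx => by_contra fun h => hx (hsub x h)) (isClosed_tsupport _)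
    rw [setIntegral_eq_integral_of_forall_compl_eq_zero,
      setIntegral_eq_integral_of_forall_compl_eq_zero, e2]
    · have e3 : ∫ x, fderiv ℝ φ x u * G x = ∫ x, fderiv ℝ F x u * fderiv ℝ φ x u := by
        simp only [hG, mul_comm]
      rw [e3, e1, neg_neg]
      simp only [mul_comm]
    · intro x hx; rw [hz x hx, mul_zero]
    · intro x hx
      rw [hsub (g := fun y => fderiv ℝ φ y u) x fun h => hx (h3 (hsub' h)), mul_zero]
  · rw [eLpNorm_exponent_top]
    refine essSup_le_of_ae_le _ (Eventually.of_forall fun x => ?_)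
    simp only [zero_mul, add_zero]
    rw [← ofReal_norm, ENNReal.ofReal_le_one]
    calc _ ≤ ‖lineDeriv ℝ G x u‖ + ‖q * F x‖ := norm_add_le _ _
      _ ≤ c + |q| * m := by
        rw [norm_mul, Real.norm_eq_abs, Real.norm_eq_abs]
        gcongr
        · exact hbd x
        · exact hm x
      _ ≤ 1 := hcm

/-- A function of the class with zero data forces an error at least its sup norm, since its
negative has the same data. -/
theorem le_optimalError {q : ℝ} {Ω : Set (E d)} (hconv : Convex ℝ Ω) (hclosed : IsClosed Ω)
    (hint : (interior Ω).Nonempty) {ξ : Finset (E d)} {F : E d → ℝ} (hF : F ∈ W 0 q Ω)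
    (hF' : -F ∈ W 0 q Ω) (hFc : Continuous F) (hinfo : info Ω ξ F = info Ω ξ (-F))
    {y : E d} (hy : y ∈ Ω) : ENNReal.ofReal (F y) ≤ optimalError Ω (W 0 q Ω) ξ := by
  refine le_iInf fun φ => ?_
  set m := φ (info Ω ξ F) with hm
  set e := worstCaseError Ω (W 0 q Ω) ξ φ with he
  have h1 : eLpNorm (fun x : Ω => F x - m x) ⊤ (Measure.comap Subtype.val volume) ≤ e :=
    le_iSup₂ (f := fun (f : E d → ℝ) (_ : f ∈ W 0 q Ω) =>
      eLpNorm (fun x : Ω => f x - φ (info Ω ξ f) x) ⊤ (Measure.comap Subtype.val volume)) F hF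
  have h2 : eLpNorm (fun x : Ω => (-F) x - m x) ⊤ (Measure.comap Subtype.val volume) ≤ e := by
    rw [hm, hinfo]
    exact le_iSup₂ (f := fun (f : E d → ℝ) (_ : f ∈ W 0 q Ω) =>
      eLpNorm (fun x : Ω => f x - φ (info Ω ξ f) x) ⊤ (Measure.comap Subtype.val volume)) (-F) hF'
  by_contra! hlt
  have hee : e ≠ ⊤ := ne_top_of_lt hlt
  rw [eLpNorm_exponent_top] at h1 h2
  have hae : ∀ᵐ x : Ω ∂(Measure.comap Subtype.val volume), F x ≤ e.toReal := by
    filter_upwards [enorm_ae_le_eLpNormEssSup (fun x : Ω => F x - m x)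
        (Measure.comap Subtype.val volume),
      enorm_ae_le_eLpNormEssSup (fun x : Ω => (-F) x - m x)
        (Measure.comap Subtype.val volume)] with x hx1 hx2
    have k1 := ENNReal.toReal_mono hee (hx1.trans h1)
    have k2 := ENNReal.toReal_mono hee (hx2.trans h2)
    rw [toReal_enorm, Real.norm_eq_abs, abs_le] at k1 k2
    simp only [Pi.neg_apply] at k2
    linarith [k1.2, k2.1]
  rw [← ae_restrict_iff_subtype hclosed.measurableSet (p := fun x => F x ≤ e.toReal)] at hae
  set V : Set (E d) := {x | e.toReal < F x} ∩ interior Ω with hV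
  have hVo : IsOpen V := (isOpen_lt continuous_const hFc).inter isOpen_interior
  have hyV : e.toReal < F y := (ENNReal.lt_ofReal_iff_toReal_lt hee).1 hlt
  have hVne : V.Nonempty := by
    have hyc : y ∈ closure (interior Ω) := by
      rw [hconv.closure_interior_eq_closure_of_nonempty_interior hint]
      exact subset_closure hy
    exact mem_closure_iff.1 hyc _ (isOpen_lt continuous_const hFc) hyV
  have hae2 := ae_restrict_of_ae_restrict_of_subset
    (inter_subset_right.trans interior_subset : V ⊆ Ω) hae
  have hzero : volume V = 0 := by
    rw [ae_restrict_iff' hVo.measurableSet] at hae2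
    refine measure_mono_null (fun x hx => ?_) hae2
    simp only [mem_compl_iff, mem_ofPred_eq]
    exact fun h => absurd (h hx) (not_le.2 hx.1)
  exact (hVo.measure_pos volume hVne).ne' hzero

theorem hasDerivAt_max_zero_sq (x : ℝ) :
    HasDerivAt (fun x : ℝ => max 0 x ^ 2) (2 * max 0 x) x := by
  have h : (fun y : ℝ => max 0 y ^ 2 - max 0 x ^ 2 - 2 * max 0 x * (y - x)) =O[𝓝 x]
      fun y => ‖y - x‖ ^ 2 := by
    refine Asymptotics.IsBigO.of_bound 1 (Eventually.of_forall fun y => ?_)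
    rw [one_mul, norm_pow, norm_norm, Real.norm_eq_abs, Real.norm_eq_abs, sq_abs, abs_le]
    rcases max_cases 0 x with ⟨e1, h1⟩ | ⟨e1, h1⟩ <;>
      rcases max_cases 0 y with ⟨e2, h2⟩ | ⟨e2, h2⟩ <;> rw [e1, e2] <;>
      constructor <;> nlinarith
  have h1 := (h.hasFDerivAt one_lt_two).hasDerivAt
  have h2 := (h1.add (((hasDerivAt_id x).sub_const x).const_mul (2 * max 0 x))).add_const
    (max 0 x ^ 2)
  refine (h2.congr_deriv (by simp)).congr_of_eventuallyEq (Eventually.of_forall fun y => ?_)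
  simp

/-- The slope of the radial profile of the extremal bump: the tent of height `h / 2` on
`[0, h]`. -/
noncomputable def tent (h r : ℝ) : ℝ := max 0 (h - r) - 2 * max 0 (h / 2 - r)

theorem tent_nonneg {h r : ℝ} (hr : 0 ≤ r) : 0 ≤ tent h r := by
  unfold tent; grind

theorem tent_le {h r : ℝ} (hr : 0 ≤ r) : tent h r ≤ r := by
  unfold tent; grind

theorem abs_tent_sub_le {h : ℝ} (hh : 0 < h) (r s : ℝ) : |tent h r - tent h s| ≤ |r - s| := by
  unfold tent; grind

/-- The extremal bump `h² / 4 - r² / 2` for `r ≤ h / 2`, `(h - r)² / 2` for `h / 2 ≤ r ≤ h`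
and `0` for `r ≥ h`, where `r = ‖v‖`. -/
noncomputable def bump {d : ℕ} (h : ℝ) (v : E d) : ℝ :=
  max 0 (h - ‖v‖) ^ 2 / 2 - max 0 (h / 2 - ‖v‖) ^ 2

theorem bump_zero {h : ℝ} (hh : 0 < h) : bump h (0 : E d) = h ^ 2 / 4 := by
  rw [bump, norm_zero, sub_zero, sub_zero, max_eq_right hh.le, max_eq_right (by linarith)]
  ring

theorem bump_eq_zero {h : ℝ} (hh : 0 < h) {v : E d} (hv : h ≤ ‖v‖) : bump h v = 0 := by
  rw [bump, max_eq_left (by linarith), max_eq_left (by linarith)]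
  norm_num

theorem bump_le {h : ℝ} (hh : 0 < h) (v : E d) :
    0 ≤ bump h v ∧ bump h v ≤ h ^ 2 / 4 ∧ h ^ 2 / 4 - ‖v‖ ^ 2 / 2 ≤ bump h v := by
  have hv := norm_nonneg v
  unfold bump
  rcases max_cases 0 (h - ‖v‖) with ⟨e1, h1⟩ | ⟨e1, h1⟩ <;>
    rcases max_cases 0 (h / 2 - ‖v‖) with ⟨e2, h2⟩ | ⟨e2, h2⟩ <;> rw [e1, e2] <;>
    refine ⟨?_, ?_, ?_⟩ <;> nlinarith

theorem hasFDerivAt_bump {h : ℝ} (hh : 0 < h) (v : E d) :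
    HasFDerivAt (bump h) (innerSL ℝ (-(tent h ‖v‖ / ‖v‖) • v)) v := by
  rcases eq_or_ne v 0 with rfl | hv
  · have hO : (fun v : E d => bump h v - h ^ 2 / 4) =O[𝓝 0] fun v => ‖v - 0‖ ^ 2 := by
      refine Asymptotics.IsBigO.of_bound 1 (Eventually.of_forall fun w => ?_)
      obtain ⟨-, h1, h2⟩ := bump_le hh w
      rw [one_mul, norm_pow, norm_norm, sub_zero, Real.norm_eq_abs, abs_le]
      constructor <;> nlinarith [sq_nonneg ‖w‖]
    have h1 := (hO.hasFDerivAt (𝕜 := ℝ) one_lt_two).add_const (h ^ 2 / 4)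
    simpa using h1
  · have hn : HasFDerivAt (fun v : E d => ‖v‖) (‖v‖⁻¹ • innerSL ℝ v) v := by
      have h1 := ((hasStrictFDerivAt_norm_sq v).hasFDerivAt).sqrt
        (pow_ne_zero 2 (norm_ne_zero_iff.2 hv))
      simp only [Real.sqrt_sq (norm_nonneg _)] at h1
      refine h1.congr_fderiv ?_
      ext w
      simp
      field_simp
    have h1 : ∀ c : ℝ, HasFDerivAt (fun v : E d => max 0 (c - ‖v‖) ^ 2)
        ((2 * max 0 (c - ‖v‖)) • -(‖v‖⁻¹ • innerSL ℝ v)) v := fun c =>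
      HasDerivAt.comp_hasFDerivAt (h₂ := fun x : ℝ => max 0 x ^ 2) v
        (hasDerivAt_max_zero_sq (c - ‖v‖)) (hn.const_sub c)
    have h2 := ((h1 h).mul_const (2⁻¹ : ℝ)).sub (h1 (h / 2))
    refine (h2.congr_fderiv ?_).congr_of_eventuallyEq (Eventually.of_forall fun w => ?_)
    · ext w
      simp [tent]
      ring
    · simp [bump, div_eq_mul_inv]

/-- The derivative of the extremal bump is `1`-Lipschitz. -/
theorem lipschitzWith_fderiv_bump {h : ℝ} (hh : 0 < h) :
    LipschitzWith 1 (fderiv ℝ (bump h : E d → ℝ)) := by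
  refine LipschitzWith.of_dist_le_mul fun v w => ?_
  rw [(hasFDerivAt_bump hh v).fderiv, (hasFDerivAt_bump hh w).fderiv, dist_eq_norm, ← map_sub,
    innerSL_apply_norm, NNReal.coe_one, one_mul, dist_eq_norm]
  set r := ‖v‖ with hr
  set s := ‖w‖ with hs
  set A := tent h r with hA
  set B := tent h s with hB
  have hr0 : 0 ≤ r := norm_nonneg v
  have hs0 : 0 ≤ s := norm_nonneg w
  have hA0 : 0 ≤ A := tent_nonneg hr0
  have hB0 : 0 ≤ B := tent_nonneg hs0
  have hAr : A / r * r = A := by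
    rcases hr0.eq_or_lt with h0 | h0
    · have : A ≤ r := tent_le hr0
      rw [← h0] at this ⊢; linarith
    · exact div_mul_cancel₀ _ h0.ne'
  have hBs : B / s * s = B := by
    rcases hs0.eq_or_lt with h0 | h0
    · have : B ≤ s := tent_le hs0
      rw [← h0] at this ⊢; linarith
    · exact div_mul_cancel₀ _ h0.ne'
  have hα : 0 ≤ A / r ∧ A / r ≤ 1 := ⟨by positivity, div_le_one_of_le₀ (tent_le hr0) hr0⟩
  have hβ : 0 ≤ B / s ∧ B / s ≤ 1 := ⟨by positivity, div_le_one_of_le₀ (tent_le hs0) hs0⟩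
  have hAB : (A - B) ^ 2 ≤ (r - s) ^ 2 := sq_le_sq.2 (abs_tent_sub_le hh r s)
  set α := A / r
  set β := B / s
  have hαβ : α * β ≤ 1 := mul_le_one₀ hα.2 hβ.1 hβ.2
  have hin : inner ℝ v w ≤ r * s := real_inner_le_norm v w
  have e1 : ‖-α • v - -β • w‖ ^ 2 = A ^ 2 + B ^ 2 - 2 * (α * β) * inner ℝ v w := by
    rw [norm_sub_sq_real, inner_smul_left, inner_smul_right, norm_smul, norm_smul, norm_neg,
      norm_neg, Real.norm_of_nonneg hα.1, Real.norm_of_nonneg hβ.1, ← hr, ← hs, hAr, hBs]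
    simp only [conj_trivial]
    ring
  have e2 : ‖v - w‖ ^ 2 = r ^ 2 + s ^ 2 - 2 * inner ℝ v w := by
    rw [norm_sub_sq_real]; ring
  refine (sq_le_sq₀ (norm_nonneg _) (norm_nonneg _)).1 ?_
  rw [e1, e2]
  have h1 : (1 - α * β) * inner ℝ v w ≤ (1 - α * β) * (r * s) :=
    mul_le_mul_of_nonneg_left hin (by linarith)
  have h2 : α * β * (r * s) = A * B := by
    rw [← hAr, ← hBs]; ring
  nlinarith

/-- If the closed `h`-ball around a point of the body contains no node, the recovery error is at
least `h² / 4`, up to the correction for the zero order term. -/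
theorem le_optimalError_of_empty_ball {q h : ℝ} {Ω : Set (E d)} (hconv : Convex ℝ Ω)
    (hclosed : IsClosed Ω) (hint : (interior Ω).Nonempty) (hh : 0 < h) {ξ : Finset (E d)}
    {y : E d} (hy : y ∈ Ω) (hξ : ∀ x ∈ ξ, h < dist x y) :
    ENNReal.ofReal (h ^ 2 / 4 / (1 + |q| * h ^ 2 / 4)) ≤ optimalError Ω (W 0 q Ω) ξ := by
  set c : ℝ := (1 + |q| * h ^ 2 / 4)⁻¹ with hc
  have hcpos : 0 < 1 + |q| * h ^ 2 / 4 := by positivity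
  have hc0 : 0 ≤ c := by positivity
  have hmem : ∀ ε : ℝ, |ε| = 1 → (fun x => ε * c * bump h (x - y)) ∈ W 0 q Ω := by
    intro ε hε
    have hd : ∀ x, HasFDerivAt (fun x => ε * c * bump h (x - y))
        ((ε * c) • fderiv ℝ (bump h) (x - y)) x := fun x => by
      have h1 := (hasFDerivAt_bump hh (x - y)).differentiableAt.hasFDerivAt
      exact (h1.comp x ((hasFDerivAt_id x).sub_const y)).const_mul (ε * c)
    have hfd : fderiv ℝ (fun x => ε * c * bump h (x - y)) =
        fun x => (ε * c) • fderiv ℝ (bump h) (x - y) := funext fun x => (hd x).fderiv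
    have hlip : LipschitzWith c.toNNReal (fderiv ℝ (fun x => ε * c * bump h (x - y))) := by
      refine LipschitzWith.of_dist_le_mul fun x z => ?_
      have h1 := (lipschitzWith_fderiv_bump (d := d) hh).dist_le_mul (x - y) (z - y)
      rw [dist_sub_right, NNReal.coe_one, one_mul] at h1
      simp only [hfd]
      rw [dist_eq_norm, ← smul_sub, norm_smul, ← dist_eq_norm, norm_mul, Real.norm_eq_abs, hε,
        one_mul, Real.norm_of_nonneg hc0,
        Real.coe_toNNReal _ hc0]
      gcongr
    have hcd : ContDiff ℝ 1 (fun x => ε * c * bump h (x - y)) :=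
      contDiff_one_iff_fderiv.2 ⟨fun x => (hd x).differentiableAt, hlip.continuous⟩
    have hcs : HasCompactSupport (fun x => ε * c * bump h (x - y)) := by
      refine HasCompactSupport.intro (isCompact_closedBall y h) fun x hx => ?_
      rw [Metric.mem_closedBall, not_le, dist_eq_norm] at hx
      rw [bump_eq_zero hh hx.le, mul_zero]
    refine mem_W_of_lipschitz_fderiv (m := c * (h ^ 2 / 4)) hcd hcs hlip (fun x => ?_) ?_
    · rw [abs_mul, abs_mul, hε, one_mul, abs_of_nonneg hc0, abs_of_nonneg (bump_le hh _).1]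
      gcongr
      exact (bump_le hh _).2.1
    · rw [Real.coe_toNNReal _ hc0]
      apply le_of_eq
      rw [hc]
      field_simp
  have hinf : ∀ ε : ℝ, info Ω ξ (fun x => ε * c * bump h (x - y)) = fun _ => (0, 0) := by
    intro ε
    funext ⟨x, hx⟩
    have hev : (fun x => ε * c * bump h (x - y)) =ᶠ[𝓝 x] fun _ => 0 := by
      have : ∀ᶠ z in 𝓝 x, h < dist z y :=
        (continuous_id.dist continuous_const).continuousAt.eventually_const_lt (hξ x hx)
      filter_upwards [this] with z hz
      rw [dist_eq_norm] at hz
      rw [bump_eq_zero hh hz.le, mul_zero]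
    simp only [info, Prod.mk.injEq]
    refine ⟨hev.eq_of_nhds, ?_⟩
    rw [gradientWithin, (hev.filter_mono nhdsWithin_le_nhds).fderivWithin_eq hev.eq_of_nhds]
    simp
  have hneg : -(fun x => 1 * c * bump h (x - y)) = fun x => (-1) * c * bump h (x - y) := by
    ext x; simp
  have h1 := le_optimalError hconv hclosed hint (hmem 1 (by simp))
    (by rw [hneg]; exact hmem (-1) (by simp)) ?_ (by rw [hneg, hinf, hinf]) hy
  · simp only [sub_self, bump_zero hh, one_mul] at h1
    rwa [hc, mul_comm, ← div_eq_mul_inv] at h1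
  · have : Continuous (bump h : E d → ℝ) := by unfold bump; fun_prop
    fun_prop

/-! ### Averaging over translates of a sphere covering -/

theorem tsum_subtype_indicator_const (S B : Set (E d)) (v : ℝ≥0∞) :
    ∑' c : S, B.indicator (fun _ => v) (c : E d) = (S ∩ B).encard * v := by
  rw [tsum_subtype S (B.indicator fun _ => v), indicator_indicator,
    ← tsum_subtype (S ∩ B) (fun _ => v), ENNReal.tsum_set_const]

/-- Averaging over translates: if `t + A ⊆ B` for all `t ∈ Q`, then some translate of `A` by an
element of `Q` contains no more than the average number of points of `S ∩ B`. -/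
theorem exists_translate_encard_le {S A B Q : Set (E d)} (hS : S.Countable)
    (hA : MeasurableSet A) (hQ : MeasurableSet Q) (hQ0 : volume Q ≠ 0) (hQt : volume Q ≠ ⊤)
    (hsub : ∀ t ∈ Q, ∀ a ∈ A, t + a ∈ B) :
    ∃ t ∈ Q, ((S ∩ {c | c - t ∈ A}).encard : ℝ≥0∞) * volume Q ≤ (S ∩ B).encard * volume A := by
  have : Countable S := hS.to_subtype
  have hm : ∀ c : S, Measurable fun t : E d => A.indicator (fun _ => (1 : ℝ≥0∞)) ((c : E d) - t) :=
    fun c => (measurable_const.indicator hA).comp (measurable_const.sub measurable_id)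
  obtain ⟨t, ht, hle⟩ := exists_le_setLAverage (μ := volume)
    (f := fun t => ∑' c : S, A.indicator (fun _ => (1 : ℝ≥0∞)) ((c : E d) - t)) hQ0 hQt
    (Measurable.tsum hm).aemeasurable
  refine ⟨t, ht, ?_⟩
  have h1 : ∑' c : S, A.indicator (fun _ => (1 : ℝ≥0∞)) ((c : E d) - t) =
      (S ∩ {c | c - t ∈ A}).encard := by
    rw [← mul_one ((S ∩ {c | c - t ∈ A}).encard : ℝ≥0∞), ← tsum_subtype_indicator_const]
    rfl
  have h2 : ∫⁻ t in Q, ∑' c : S, A.indicator (fun _ => (1 : ℝ≥0∞)) ((c : E d) - t) ≤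
      (S ∩ B).encard * volume A := by
    rw [lintegral_tsum fun c => (hm c).aemeasurable, ← tsum_subtype_indicator_const]
    refine ENNReal.tsum_le_tsum fun c => ?_
    by_cases hc : (c : E d) ∈ B
    · rw [indicator_of_mem hc]
      refine (setLIntegral_le_lintegral _ _).trans ?_
      rw [lintegral_sub_left_eq_self (fun t : E d => A.indicator (fun _ => (1 : ℝ≥0∞)) t) (c : E d),
        lintegral_indicator_const hA, one_mul]
    · rw [indicator_of_notMem hc, nonpos_iff_eq_zero, setLIntegral_eq_zero hQ]
      intro t ht
      refine indicator_of_notMem (fun hA' => hc ?_) _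
      simpa using hsub t ht _ hA'
  rw [h1, setLAverage_eq, ENNReal.le_div_iff_mul_le (Or.inl hQ0) (Or.inl hQt)] at hle
  exact hle.trans h2

theorem volume_cube (d : ℕ) (R : ℝ) : volume (cube d R) = ENNReal.ofReal (2 * R) ^ d := by
  have h1 : cube d R = WithLp.ofLp ⁻¹' (Icc (fun _ => -R) (fun _ => R) : Set (Fin d → ℝ)) := by
    ext x
    simp only [cube, mem_ofPred_eq, mem_preimage, mem_Icc, Pi.le_def]
    exact forall_and
  rw [h1, (PiLp.volume_preserving_ofLp (Fin d)).measure_preimage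
    measurableSet_Icc.nullMeasurableSet, Real.volume_Icc_pi]
  simp [two_mul]

theorem isClosed_cube (d : ℕ) (R : ℝ) : IsClosed (cube d R) := by
  have : cube d R = ⋂ i, (fun x : E d => x i) ⁻¹' Icc (-R) R := by
    ext x; simp [cube]
  rw [this]
  exact isClosed_iInter fun i => isClosed_Icc.preimage (by fun_prop)

theorem mem_cube_iff {R : ℝ} {x : E d} : x ∈ cube d R ↔ ∀ i, |x i| ≤ R := by
  simp only [cube, mem_ofPred_eq, mem_Icc, abs_le]

theorem abs_apply_le_norm (x : E d) (i : Fin d) : |x i| ≤ ‖x‖ := PiLp.norm_apply_le x i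

theorem closedBall_subset_cube (ρ : ℝ) : Metric.closedBall (0 : E d) ρ ⊆ cube d ρ := by
  intro x hx
  rw [mem_closedBall_zero_iff] at hx
  exact mem_cube_iff.2 fun i => (abs_apply_le_norm x i).trans hx

theorem add_mem_cube {R S : ℝ} {x y : E d} (hx : x ∈ cube d R) (hy : y ∈ cube d S) :
    x + y ∈ cube d (R + S) :=
  mem_cube_iff.2 fun i => (abs_add_le (x i) (y i)).trans
    (add_le_add (mem_cube_iff.1 hx i) (mem_cube_iff.1 hy i))

theorem norm_le_of_mem_cube {a : ℝ} (ha : 0 ≤ a) {x : E d} (hx : x ∈ cube d a) :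
    ‖x‖ ≤ √d * a := by
  rw [EuclideanSpace.norm_eq]
  refine (Real.sqrt_le_sqrt (Finset.sum_le_sum fun i _ => pow_le_pow_left₀ (norm_nonneg _)
    (mem_cube_iff.1 hx i) 2)).trans ?_
  rw [Finset.sum_const, Finset.card_univ, Fintype.card_fin, nsmul_eq_mul,
    Real.sqrt_mul (Nat.cast_nonneg d), Real.sqrt_sq ha]

theorem volume_closedBall_eq (c : E d) {r : ℝ} (hr : 0 ≤ r) :
    volume (Metric.closedBall c r) =
      ENNReal.ofReal (r ^ d) * volume (Metric.ball (0 : E d) 1) := by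
  rw [Measure.addHaar_closedBall volume c hr, finrank_euclideanSpace_fin]

theorem volume_unit_ball_ne_zero : volume (Metric.ball (0 : E d) 1) ≠ 0 :=
  (Metric.measure_ball_pos volume _ one_pos).ne'

theorem volume_unit_ball_ne_top : volume (Metric.ball (0 : E d) 1) ≠ ⊤ :=
  measure_ball_lt_top.ne

theorem IsSphereCovering.exists_dist_le {S : Set (E d)} {r : ℝ} (h : IsSphereCovering d S r)
    (x : E d) : ∃ c ∈ S, dist x c ≤ r := by
  have : x ∈ ⋃ c ∈ S, Metric.closedBall c r := by rw [h.2.2]; trivial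
  simpa using this

/-- Rescaling and translating a sphere covering to radius `h`. -/
theorem IsSphereCovering.rescale {S : Set (E d)} {r h : ℝ} (hS : IsSphereCovering d S r)
    (hh : 0 < h) (t : E d) : IsSphereCovering d ((fun c => (h / r) • (c - t)) '' S) h := by
  have hr := hS.2.1
  refine ⟨hS.1.image _, hh, eq_univ_of_forall fun x => ?_⟩
  obtain ⟨c, hc, hxc⟩ := hS.exists_dist_le (t + (r / h) • x)
  simp only [mem_iUnion, mem_image, Metric.mem_closedBall]
  refine ⟨_, ⟨c, hc, rfl⟩, ?_⟩
  have e : x - (h / r) • (c - t) = (h / r) • (t + (r / h) • x - c) := by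
    have h1 : (h / r) • (r / h) • x = x := by
      rw [smul_smul, div_mul_div_cancel₀ hr.ne', div_self hh.ne', one_smul]
    rw [smul_sub, smul_sub, smul_add, h1]
    abel
  rw [dist_eq_norm] at hxc ⊢
  rw [e, norm_smul, Real.norm_of_nonneg (by positivity)]
  calc h / r * ‖t + (r / h) • x - c‖ ≤ h / r * r := by gcongr
    _ = h := div_mul_cancel₀ h hr.ne'

/-- The balls centred in the smaller cube lie in the larger one and count fully for the density. -/
theorem encard_inter_cube_mul_le (S : Set (E d)) {r : ℝ} (hr : 0 ≤ r) (R : ℝ) :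
    ((S ∩ cube d (R - r)).encard : ℝ≥0∞) *
        (ENNReal.ofReal (r ^ d) * volume (Metric.ball (0 : E d) 1)) ≤
      ∑' c : S, volume (Metric.closedBall (c : E d) r ∩ cube d R) := by
  rw [← tsum_subtype_indicator_const]
  refine ENNReal.tsum_le_tsum fun c => ?_
  refine indicator_le' (f := fun _ => _) (g := fun c : E d =>
    volume (Metric.closedBall c r ∩ cube d R)) (fun c hc => ?_) (fun _ _ => zero_le) (c : E d)
  rw [← volume_closedBall_eq c hr]
  refine measure_mono (subset_inter subset_rfl fun x hx => ?_)
  have h1 : x - c ∈ cube d r := closedBall_subset_cube r (by simpa [dist_eq_norm] using hx)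
  simpa using add_mem_cube hc h1

theorem eventually_mul_cube_le {a b : ℝ} (hab : a < b) (s : ℝ) (d : ℕ) :
    ∀ᶠ R : ℝ in atTop, a * (2 * R) ^ d ≤ b * (2 * (R - s)) ^ d := by
  have h1 : Tendsto (fun R : ℝ => b * (1 - s / R) ^ d) atTop (𝓝 (b * (1 - 0) ^ d)) :=
    ((tendsto_const_nhds.sub (tendsto_const_nhds.div_atTop tendsto_id)).pow d).const_mul b
  rw [sub_zero, one_pow, mul_one] at h1
  filter_upwards [h1.eventually_const_lt hab, eventually_gt_atTop 0] with R hR hR0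
  calc a * (2 * R) ^ d ≤ b * (1 - s / R) ^ d * (2 * R) ^ d := by gcongr
    _ = b * (2 * (R - s)) ^ d := by
      rw [mul_assoc, ← mul_pow]
      congr 2
      field_simp

open scoped Pointwise in
/-- Any bounded set `A` meets the set of centres of a suitable covering of the whole space by
balls of radius `h` in nearly as few points as the least covering density predicts. -/
theorem exists_covering_card_le {D : ℝ} (hD0 : 0 ≤ D) (hD : dens d < ENNReal.ofReal D) {h : ℝ}
    (hh : 0 < h)
    {A : Set (E d)} (hA : MeasurableSet A) (hAb : Bornology.IsBounded A) :
    ∃ S : Set (E d), IsSphereCovering d S h ∧ ∃ X : Finset (E d), (X : Set (E d)) = S ∩ A ∧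
      (X.card : ℝ≥0∞) * (ENNReal.ofReal (h ^ d) * volume (Metric.ball (0 : E d) 1)) ≤
        ENNReal.ofReal D * volume A := by
  classical
  set ν := volume (Metric.ball (0 : E d) 1) with hν
  obtain ⟨D', hD'0, hdD', hD'D⟩ : ∃ D' : ℝ, 0 ≤ D' ∧ dens d < ENNReal.ofReal D' ∧ D' < D := by
    obtain ⟨z, hz1, hz2⟩ := exists_between hD
    have hzt : z ≠ ⊤ := ne_top_of_lt hz2
    exact ⟨z.toReal, ENNReal.toReal_nonneg, by rwa [ENNReal.ofReal_toReal hzt],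
      (ENNReal.lt_ofReal_iff_toReal_lt hzt).1 hz2⟩
  obtain ⟨S, r, hS, hSD⟩ : ∃ S r, IsSphereCovering d S r ∧
      coveringDensity d S r < ENNReal.ofReal D' := by
    simp only [dens, iInf_lt_iff] at hdD'
    obtain ⟨S, r, hS, hlt⟩ := hdD'
    exact ⟨S, r, hS, hlt⟩
  have hr := hS.2.1
  -- In a large cube on which the density of `S` is small, look at translates of `(r / h) A`.
  obtain ⟨ρ, hρ⟩ := (hAb.smul₀ (r / h)).subset_closedBall 0
  obtain ⟨R, hRD, hRle, hRbig⟩ := ((frequently_lt_of_liminf_lt (by isBoundedDefault)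
    hSD).and_eventually ((eventually_mul_cube_le hD'D (r + ρ) d).and
      (eventually_gt_atTop (max 0 (r + ρ))))).exists
  have hR0 : 0 < R := (le_max_left _ _).trans_lt hRbig
  have hRρ : r + ρ < R := (le_max_right _ _).trans_lt hRbig
  have hposs : ENNReal.ofReal (2 * (R - (r + ρ))) ^ d ≠ 0 :=
    pow_ne_zero _ (by simpa using hRρ)
  have htops : ENNReal.ofReal (2 * (R - (r + ρ))) ^ d ≠ ⊤ := by finiteness
  obtain ⟨t, -, ht⟩ := exists_translate_encard_le (A := (r / h) • A) (B := cube d (R - r))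
    (Q := cube d (R - (r + ρ))) hS.1 (hA.const_smul₀ (r / h)) (isClosed_cube d _).measurableSet
    (by rwa [volume_cube]) (by rwa [volume_cube]) (fun t ht a ha => by
      have := add_mem_cube ht (closedBall_subset_cube ρ (hρ ha))
      rwa [show R - (r + ρ) + ρ = R - r by ring] at this)
  set K : ℝ≥0∞ := ((S ∩ {c | c - t ∈ (r / h) • A}).encard : ℝ≥0∞) with hK
  have hcount := encard_inter_cube_mul_le S hr.le R
  rw [ENNReal.div_lt_iff (Or.inl (by rw [volume_cube]; exact pow_ne_zero _ (by simpa using hR0)))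
    (Or.inl (by rw [volume_cube]; finiteness)), volume_cube] at hRD
  rw [volume_cube, Measure.addHaar_smul, finrank_euclideanSpace_fin,
    abs_of_nonneg (by positivity)] at ht
  have hDD : ENNReal.ofReal D' * ENNReal.ofReal (2 * R) ^ d ≤
      ENNReal.ofReal D * ENNReal.ofReal (2 * (R - (r + ρ))) ^ d := by
    rw [← ENNReal.ofReal_pow (by positivity), ← ENNReal.ofReal_pow (by linarith),
      ← ENNReal.ofReal_mul hD'0, ← ENNReal.ofReal_mul hD0]
    exact ENNReal.ofReal_le_ofReal hRle
  have hmain : K * (ENNReal.ofReal (h ^ d) * ν) ≤ ENNReal.ofReal D * volume A := by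
    set V := ENNReal.ofReal (2 * (R - (r + ρ))) ^ d
    set N : ℝ≥0∞ := ((S ∩ cube d (R - r)).encard : ℝ≥0∞)
    have e : ENNReal.ofReal ((r / h) ^ d) * ENNReal.ofReal (h ^ d) = ENNReal.ofReal (r ^ d) := by
      rw [← ENNReal.ofReal_mul (by positivity), ← mul_pow, div_mul_cancel₀ _ hh.ne']
    have k1 : K * (ENNReal.ofReal (h ^ d) * ν) * V ≤ ENNReal.ofReal D * volume A * V := by
      calc K * (ENNReal.ofReal (h ^ d) * ν) * V = K * V * (ENNReal.ofReal (h ^ d) * ν) := by ring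
        _ ≤ N * (ENNReal.ofReal ((r / h) ^ d) * volume A) * (ENNReal.ofReal (h ^ d) * ν) := by
          gcongr
        _ = N * (ENNReal.ofReal (r ^ d) * ν) * volume A := by rw [← e]; ring
        _ ≤ ENNReal.ofReal D' * ENNReal.ofReal (2 * R) ^ d * volume A := by
          exact mul_le_mul_left (hcount.trans hRD.le) _
        _ ≤ ENNReal.ofReal D * V * volume A := by gcongr
        _ = _ := by ring
    exact (ENNReal.mul_le_mul_iff_left hposs htops).1 k1
  have hKfin : (S ∩ {c | c - t ∈ (r / h) • A}).Finite := by
    rw [← encard_ne_top_iff]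
    intro htop
    have hne : ENNReal.ofReal (h ^ d) * ν ≠ 0 :=
      mul_ne_zero (by simpa using pow_pos hh d) volume_unit_ball_ne_zero
    rw [hK, htop, ENat.toENNReal_top, ENNReal.top_mul hne, top_le_iff] at hmain
    exact ENNReal.mul_ne_top ENNReal.ofReal_ne_top hAb.measure_lt_top.ne hmain
  have hinj : Function.Injective fun c : E d => (h / r) • (c - t) := fun x y hxy => by
    simpa [hh.ne', hr.ne'] using hxy
  refine ⟨_, hS.rescale hh t, hKfin.toFinset.image fun c => (h / r) • (c - t), ?_, ?_⟩
  · ext x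
    simp only [Finset.coe_image, Finite.coe_toFinset, mem_image, mem_inter_iff, mem_ofPred_eq]
    have hmem : ∀ c, c - t ∈ (r / h) • A ↔ (h / r) • (c - t) ∈ A := fun c => by
      rw [mem_smul_set_iff_inv_smul_mem₀ (by positivity), inv_div]
    constructor
    · rintro ⟨c, ⟨hc, hcA⟩, rfl⟩
      exact ⟨⟨c, hc, rfl⟩, (hmem c).1 hcA⟩
    · rintro ⟨⟨c, hc, rfl⟩, hA'⟩
      exact ⟨c, ⟨hc, (hmem c).2 hA'⟩, rfl⟩
  · rw [Finset.card_image_of_injective _ hinj]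
    rw [hK, hKfin.encard_eq_coe_toFinset_card] at hmain
    simpa using hmain

/-! ### Periodic coverings and the size of `dens d` -/

/-- The vector with coordinates `2 b jᵢ`, a point of the lattice `(2 b ℤ)^d`. -/
noncomputable def latticePoint (b : ℝ) (j : Fin d → ℤ) : E d :=
  WithLp.toLp 2 fun i => 2 * b * (j i : ℝ)

@[simp]
theorem latticePoint_apply (b : ℝ) (j : Fin d → ℤ) (i : Fin d) :
    latticePoint b j i = 2 * b * j i := rfl

/-- Translating a finite covering of a cube of side `2 b` along `(2 b ℤ)^d` covers the space. -/
theorem isSphereCovering_periodic {X : Finset (E d)} {h b : ℝ} (hh : 0 < h) (hb : 0 < b) {t : E d}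
    (hcov : ∀ x, x - t ∈ cube d b → ∃ c ∈ X, dist x c ≤ h) :
    IsSphereCovering d (range fun p : X × (Fin d → ℤ) => (p.1 : E d) + latticePoint b p.2) h := by
  refine ⟨countable_range _, hh, eq_univ_of_forall fun x => ?_⟩
  let j : Fin d → ℤ := fun i => round ((x - t) i / (2 * b))
  obtain ⟨c, hc, hxc⟩ := hcov (x - latticePoint b j) (mem_cube_iff.2 fun i => by
    have h1 := abs_sub_round ((x - t) i / (2 * b))
    have e : (x - latticePoint b j - t) i =
        2 * b * ((x - t) i / (2 * b) - round ((x - t) i / (2 * b))) := by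
      simp only [PiLp.sub_apply, latticePoint_apply, j]
      field_simp
      ring
    rw [e, abs_mul, abs_of_pos (by positivity)]
    nlinarith)
  simp only [mem_iUnion, Metric.mem_closedBall]
  refine ⟨_, ⟨(⟨c, hc⟩, j), rfl⟩, ?_⟩
  rw [dist_eq_norm] at hxc ⊢
  rwa [← sub_sub, sub_right_comm]

/-- Number of lattice translates of a ball that meet a large cube. -/
theorem tsum_lattice_le {h b C R : ℝ} (hh : 0 < h) (hb : 0 < b) {c : E d} (hc : ‖c‖ + h ≤ C)
    (hR : 0 < R) :
    ∑' j : Fin d → ℤ, volume (Metric.closedBall (c + latticePoint b j) h ∩ cube d R) ≤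
      ENNReal.ofReal (((R + C) / b + 1) ^ d) *
        (ENNReal.ofReal (h ^ d) * volume (Metric.ball (0 : E d) 1)) := by
  have hC : 0 ≤ C := (by positivity : 0 ≤ ‖c‖ + h).trans hc
  set m : ℤ := ⌊(R + C) / (2 * b)⌋ with hm
  have hm0 : 0 ≤ m := Int.floor_nonneg.2 (by positivity)
  set J : Finset (Fin d → ℤ) := Fintype.piFinset fun _ => Finset.Icc (-m) m with hJ
  have hzero : ∀ j ∉ J, volume (Metric.closedBall (c + latticePoint b j) h ∩ cube d R) = 0 := by
    intro j hj
    rw [← nonpos_iff_eq_zero, ← measure_empty (μ := (volume : Measure (E d)))]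
    refine measure_mono fun x hx => hj ?_
    rw [hJ, Fintype.mem_piFinset]
    intro i
    have h1 := (abs_apply_le_norm _ i).trans (by simpa [dist_eq_norm] using hx.1 :
      ‖x - (c + latticePoint b j)‖ ≤ h)
    have h2 := mem_cube_iff.1 hx.2 i
    have h3 := abs_apply_le_norm c i
    simp only [PiLp.sub_apply, PiLp.add_apply, latticePoint_apply] at h1
    have h4 : |(j i : ℝ)| ≤ (R + C) / (2 * b) := by
      rw [le_div_iff₀ (by positivity), ← abs_of_pos (by positivity : 0 < 2 * b), ← abs_mul]
      rw [abs_le] at *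
      constructor <;> linarith [h1.1, h1.2, h2.1, h2.2, h3.1, h3.2]
    rw [Finset.mem_Icc, ← abs_le, hm, Int.le_floor]
    exact_mod_cast h4
  rw [tsum_eq_sum (s := J) fun j hj => hzero j hj]
  have hcard : (J.card : ℝ) ≤ ((R + C) / b + 1) ^ d := by
    rw [hJ, Fintype.card_piFinset_const, Int.card_Icc]
    push_cast
    gcongr
    have h1 : ((m + 1 - -m).toNat : ℝ) = 2 * m + 1 := by
      rw [← Int.cast_natCast, Int.toNat_of_nonneg (by omega)]
      push_cast; ring
    have h2 : (m : ℝ) ≤ (R + C) / (2 * b) := Int.floor_le _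
    have h3 : 2 * ((R + C) / (2 * b)) = (R + C) / b := by field_simp
    rw [h1]; linarith
  calc ∑ j ∈ J, volume (Metric.closedBall (c + latticePoint b j) h ∩ cube d R)
      ≤ ∑ j ∈ J, ENNReal.ofReal (h ^ d) * volume (Metric.ball (0 : E d) 1) :=
        Finset.sum_le_sum fun j _ => by
          rw [← volume_closedBall_eq (c + latticePoint b j) hh.le]
          exact measure_mono inter_subset_left
    _ = (J.card : ℝ≥0∞) * (ENNReal.ofReal (h ^ d) * volume (Metric.ball (0 : E d) 1)) := by
        rw [Finset.sum_const, nsmul_eq_mul]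
    _ ≤ _ := by
        gcongr
        rw [← ENNReal.ofReal_natCast]
        exact ENNReal.ofReal_le_ofReal hcard

/-- A finite covering of a cube by balls of radius `h` bounds the least covering density. -/
theorem dens_mul_le_of_cover_cube {X : Finset (E d)} {h b : ℝ} (hh : 0 < h) (hb : 0 < b) {t : E d}
    (hcov : ∀ x, x - t ∈ cube d b → ∃ c ∈ X, dist x c ≤ h) :
    dens d * ENNReal.ofReal ((2 * b) ^ d) ≤
      X.card * (ENNReal.ofReal (h ^ d) * volume (Metric.ball (0 : E d) 1)) := by
  set w := ENNReal.ofReal (h ^ d) * volume (Metric.ball (0 : E d) 1) with hw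
  have hwt : (X.card : ℝ≥0∞) * w ≠ ⊤ :=
    ENNReal.mul_ne_top (ENNReal.natCast_ne_top _)
      (ENNReal.mul_ne_top ENNReal.ofReal_ne_top volume_unit_ball_ne_top)
  set g : X × (Fin d → ℤ) → E d := fun p => (p.1 : E d) + latticePoint b p.2 with hg
  have hS := isSphereCovering_periodic hh hb hcov
  obtain ⟨C₀, hC₀⟩ := X.finite_toSet.isBounded.subset_closedBall (0 : E d)
  have hXC : ∀ c ∈ X, ‖c‖ + h ≤ C₀ + h := fun c hc => by
    have := hC₀ (Finset.mem_coe.2 hc)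
    rw [mem_closedBall_zero_iff] at this
    linarith
  set C := C₀ + h
  have hbound : ∀ R : ℝ, 0 < R →
      (∑' c : range g, volume (Metric.closedBall (c : E d) h ∩ cube d R)) / volume (cube d R) ≤
        X.card * w * ENNReal.ofReal ((((R + C) / b + 1) / (2 * R)) ^ d) := by
    intro R hR
    have h1 : ∑' c : range g, volume (Metric.closedBall (c : E d) h ∩ cube d R) ≤
        X.card * (ENNReal.ofReal (((R + C) / b + 1) ^ d) * w) := by
      calc _ ≤ ∑' p : X × (Fin d → ℤ), volume (Metric.closedBall (g p) h ∩ cube d R) :=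
            ENNReal.tsum_le_tsum_comp_of_surjective (rangeFactorization_surjective (f := g))
              fun c : range g => volume (Metric.closedBall (c : E d) h ∩ cube d R)
        _ = ∑' (c : X) (j : Fin d → ℤ),
              volume (Metric.closedBall ((c : E d) + latticePoint b j) h ∩ cube d R) :=
            ENNReal.tsum_prod (f := fun (c : X) (j : Fin d → ℤ) =>
              volume (Metric.closedBall ((c : E d) + latticePoint b j) h ∩ cube d R))
        _ ≤ ∑' c : X, ENNReal.ofReal (((R + C) / b + 1) ^ d) * w :=
            ENNReal.tsum_le_tsum fun c => tsum_lattice_le hh hb (hXC c c.2) hR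
        _ = _ := by
            rw [tsum_fintype, Finset.sum_const, Finset.card_univ, Fintype.card_coe, nsmul_eq_mul]
    rw [volume_cube, ← ENNReal.ofReal_pow (by positivity)]
    refine (ENNReal.div_le_div_right h1 _).trans (le_of_eq ?_)
    rw [div_pow, ENNReal.ofReal_div_of_pos (by positivity), mul_div_assoc', mul_comm _ w,
      ← mul_assoc]
  have hlim : Tendsto (fun R : ℝ => X.card * w * ENNReal.ofReal ((((R + C) / b + 1) / (2 * R)) ^ d))
      atTop (𝓝 (X.card * w * ENNReal.ofReal ((1 / (2 * b)) ^ d))) := by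
    refine ENNReal.Tendsto.const_mul ?_ (Or.inr hwt)
    refine ENNReal.tendsto_ofReal (Tendsto.pow ?_ d)
    have h1 : Tendsto (fun R : ℝ => 1 / (2 * b) + (C / b + 1) / 2 / R) atTop
        (𝓝 (1 / (2 * b) + 0)) :=
      tendsto_const_nhds.add (tendsto_const_nhds.div_atTop tendsto_id)
    rw [add_zero] at h1
    refine h1.congr' ?_
    filter_upwards [eventually_gt_atTop 0] with R hR
    field_simp
    ring
  have hdens : dens d ≤ X.card * w * ENNReal.ofReal ((1 / (2 * b)) ^ d) := by
    have h1 : dens d ≤ coveringDensity d (range g) h := by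
      unfold dens
      exact iInf_le_of_le (range g) (iInf_le_of_le h (iInf_le_of_le hS le_rfl))
    refine h1.trans ?_
    rw [← hlim.liminf_eq]
    refine liminf_le_liminf ?_
    filter_upwards [eventually_gt_atTop 0] with R hR using hbound R hR
  calc _ ≤ X.card * w * ENNReal.ofReal ((1 / (2 * b)) ^ d) * ENNReal.ofReal ((2 * b) ^ d) := by
        gcongr
    _ = X.card * w := by
        rw [mul_assoc, ← ENNReal.ofReal_mul (by positivity), ← mul_pow,
          one_div_mul_cancel (by positivity), one_pow, ENNReal.ofReal_one, mul_one]

/-- The cubic lattice yields a covering of finite density. -/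
theorem dens_ne_top (hd : 0 < d) : dens d ≠ ⊤ := by
  have hs : 0 < √(d : ℝ) := Real.sqrt_pos.2 (by exact_mod_cast hd)
  have h1 := dens_mul_le_of_cover_cube (d := d) (X := {0}) (t := 0) hs one_pos fun x hx =>
    ⟨0, by simp, by
      rw [sub_zero] at hx
      simpa using norm_le_of_mem_cube zero_le_one hx⟩
  intro htop
  rw [htop, ENNReal.top_mul (by simp), top_le_iff] at h1
  exact ENNReal.mul_ne_top (ENNReal.natCast_ne_top _)
      (ENNReal.mul_ne_top ENNReal.ofReal_ne_top volume_unit_ball_ne_top) h1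

/-- A covering has density at least one, by countable subadditivity. -/
theorem one_le_dens (d : ℕ) : 1 ≤ dens d := by
  refine le_iInf fun S => le_iInf fun r => le_iInf fun hS => ?_
  refine le_liminf_of_le (by isBoundedDefault) ?_
  filter_upwards [eventually_gt_atTop 0] with R hR
  have hpos : volume (cube d R) ≠ 0 := by
    rw [volume_cube]; exact pow_ne_zero _ (by simpa using hR)
  have htop : volume (cube d R) ≠ ⊤ := by
    rw [volume_cube]; exact ENNReal.pow_ne_top ENNReal.ofReal_ne_top
  rw [ENNReal.le_div_iff_mul_le (Or.inl hpos) (Or.inl htop), one_mul]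
  have : Countable S := hS.1.to_subtype
  refine (measure_mono fun x hx => ?_).trans (measure_iUnion_le _)
  obtain ⟨c, hc, hxc⟩ := hS.exists_dist_le x
  exact mem_iUnion.2 ⟨⟨c, hc⟩, hxc, hx⟩

/-! ### Coverings of a convex body -/

/-- The part of a convex body at distance at most `ρ` from its complement has small volume. -/
theorem tendsto_volume_boundaryLayer {Ω : Set (E d)} (hconv : Convex ℝ Ω) (hcomp : IsCompact Ω) :
    Tendsto (fun ρ => volume (Ω ∩ Metric.cthickening ρ Ωᶜ)) (𝓝 0) (𝓝 0) := by
  have hfin : IsFiniteMeasure (volume.restrict Ω) :=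
    isFiniteMeasure_restrict.2 hcomp.measure_lt_top.ne
  have h1 := tendsto_measure_cthickening (μ := volume.restrict Ω) (s := Ωᶜ)
    ⟨1, one_pos, measure_ne_top _ _⟩
  have h2 : volume.restrict Ω (closure Ωᶜ) = 0 := by
    rw [Measure.restrict_apply isClosed_closure.measurableSet, ← nonpos_iff_eq_zero,
      ← hconv.addHaar_frontier volume, frontier_eq_closure_inter_closure, hcomp.isClosed.closure_eq,
      inter_comm]
  rw [h2] at h1
  refine h1.congr fun ρ => ?_
  rw [Measure.restrict_apply Metric.isClosed_cthickening.measurableSet, inter_comm]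

theorem closedBall_subset_of_notMem_layer {Ω : Set (E d)} {ρ : ℝ} {y : E d}
    (h : y ∉ Metric.cthickening ρ Ωᶜ) : Metric.closedBall y ρ ⊆ Ω := by
  intro x hx
  by_contra hxΩ
  exact h (Metric.mem_cthickening_of_dist_le y x ρ _ hxΩ (by rwa [dist_comm]))

/-- Balls of small radius `h` covering a convex body are at least as numerous as the least
covering density predicts. -/
theorem le_card_of_cover {D : ℝ} (hD0 : 0 < D) (hD : ENNReal.ofReal D < dens d)
    {Ω : Set (E d)} (hconv : Convex ℝ Ω) (hcomp : IsCompact Ω) (hint : (interior Ω).Nonempty) :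
    ∃ h₀ > 0, ∀ h : ℝ, 0 < h → h < h₀ → ∀ ξ : Finset (E d), (∀ y ∈ Ω, ∃ x ∈ ξ, dist y x ≤ h) →
      ENNReal.ofReal D * volume Ω ≤
        ξ.card * (ENNReal.ofReal (h ^ d) * volume (Metric.ball (0 : E d) 1)) := by
  have hΩt : volume Ω ≠ ⊤ := hcomp.measure_lt_top.ne
  have hΩ0 : volume Ω ≠ 0 :=
    ((isOpen_interior.measure_pos volume hint).trans_le (measure_mono interior_subset)).ne'
  obtain ⟨D', hDD', hD'⟩ : ∃ D' : ℝ, D < D' ∧ ENNReal.ofReal D' < dens d := by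
    obtain ⟨z, hz1, hz2⟩ := exists_between hD
    have hzt : z ≠ ⊤ := ne_top_of_lt hz2
    exact ⟨z.toReal, (ENNReal.ofReal_lt_iff_lt_toReal hD0.le hzt).1 hz1,
      by rwa [ENNReal.ofReal_toReal hzt]⟩
  have hD'0 : 0 < D' := hD0.trans hDD'
  -- The set of centres of cubes inside `Ω` has almost full measure.
  obtain ⟨ρ, hρ0, hρ⟩ : ∃ ρ > 0, ENNReal.ofReal D * volume Ω <
      ENNReal.ofReal D' * volume (Ω \ Metric.cthickening ρ Ωᶜ) := by
    have h1 : Tendsto (fun ρ => ENNReal.ofReal D' *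
        (volume Ω - volume (Ω ∩ Metric.cthickening ρ Ωᶜ))) (𝓝 0)
        (𝓝 (ENNReal.ofReal D' * (volume Ω - 0))) :=
      ENNReal.Tendsto.const_mul (ENNReal.Tendsto.sub tendsto_const_nhds
        (tendsto_volume_boundaryLayer hconv hcomp) (Or.inl hΩt)) (Or.inr ENNReal.ofReal_ne_top)
    rw [tsub_zero] at h1
    have h2 : ENNReal.ofReal D * volume Ω < ENNReal.ofReal D' * volume Ω :=
      ENNReal.mul_lt_mul_left hΩ0 hΩt ((ENNReal.ofReal_lt_ofReal_iff hD'0).2 hDD')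
    obtain ⟨ρ, h3, h4⟩ := (((h1.mono_left (nhdsWithin_le_nhds (s := Ioi 0))).eventually_const_lt
      h2).and self_mem_nhdsWithin).exists
    refine ⟨ρ, h4, h3.trans_le ?_⟩
    rw [← sdiff_self_inter]
    gcongr
    exact le_measure_sdiff
  set Q := Ω \ Metric.cthickening ρ Ωᶜ with hQ
  have hQm : MeasurableSet Q :=
    hcomp.isClosed.measurableSet.diff Metric.isClosed_cthickening.measurableSet
  have hQt : volume Q ≠ ⊤ := measure_ne_top_of_subset sdiff_subset hΩt
  have hQ0 : volume Q ≠ 0 := fun h0 => by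
    rw [h0, mul_zero] at hρ
    exact not_lt_zero hρ
  obtain ⟨a, ha0, ha⟩ : ∃ a > 0, √(d : ℝ) * a ≤ ρ := by
    refine ⟨ρ / (√d + 1), by positivity, ?_⟩
    rw [mul_div_assoc', div_le_iff₀ (by positivity)]
    nlinarith [Real.sqrt_nonneg (d : ℝ)]
  have hcubeQ : ∀ t ∈ Q, ∀ v ∈ cube d a, t + v ∈ Ω := fun t ht v hv =>
    closedBall_subset_of_notMem_layer ht.2 (by
      simpa [dist_eq_norm] using (norm_le_of_mem_cube ha0.le hv).trans ha)
  have hev : ∀ᶠ h : ℝ in 𝓝 0, ENNReal.ofReal D * volume Ω * ENNReal.ofReal ((2 * a) ^ d) <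
      ENNReal.ofReal D' * volume Q * ENNReal.ofReal ((2 * (a - h)) ^ d) := by
    have h1 : Tendsto (fun h : ℝ => ENNReal.ofReal D' * volume Q *
        ENNReal.ofReal ((2 * (a - h)) ^ d)) (𝓝 0)
        (𝓝 (ENNReal.ofReal D' * volume Q * ENNReal.ofReal ((2 * (a - 0)) ^ d))) :=
      ENNReal.Tendsto.const_mul (ENNReal.tendsto_ofReal
        ((by fun_prop : Continuous fun h : ℝ => (2 * (a - h)) ^ d).tendsto 0))
        (Or.inr (ENNReal.mul_ne_top ENNReal.ofReal_ne_top hQt))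
    rw [sub_zero] at h1
    exact h1.eventually_const_lt (ENNReal.mul_lt_mul_left (by simp; positivity)
      ENNReal.ofReal_ne_top hρ)
  obtain ⟨h₁, h₁0, hh₁⟩ := Metric.eventually_nhds_iff.1 hev
  refine ⟨min h₁ a, lt_min h₁0 ha0, fun h hh hlt ξ hcov => ?_⟩
  have hha : h < a := hlt.trans_le (min_le_right _ _)
  have hstrict := hh₁ (y := h) (by
    rw [Real.dist_eq, sub_zero, abs_of_pos hh]; exact hlt.trans_le (min_le_left _ _))
  obtain ⟨t, htQ, ht⟩ := exists_translate_encard_le (S := (ξ : Set (E d))) (B := Ω)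
    ξ.countable_toSet (isClosed_cube d a).measurableSet hQm hQ0 hQt hcubeQ
  classical
  -- The centres in `t + cube d a` cover the smaller cube `t + cube d (a - h)`.
  set X := ξ.filter fun c => c - t ∈ cube d a with hX
  have hXe : ((ξ : Set (E d)) ∩ {c | c - t ∈ cube d a}).encard = X.card := by
    rw [← encard_coe_eq_coe_finsetCard]
    congr 1
    ext c; simp [hX]
  have hdens := dens_mul_le_of_cover_cube (X := X) (t := t) hh (sub_pos.2 hha) fun x hx => by
    have hxΩ : x ∈ Ω := by
      have := hcubeQ t htQ (x - t) (mem_cube_iff.2 fun i =>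
        (mem_cube_iff.1 hx i).trans (by linarith))
      simpa using this
    obtain ⟨c, hc, hxc⟩ := hcov x hxΩ
    refine ⟨c, Finset.mem_filter.2 ⟨hc, ?_⟩, hxc⟩
    have h1 : c - x ∈ cube d h := closedBall_subset_cube h (by
      rw [mem_closedBall_zero_iff, ← dist_eq_norm, dist_comm]; exact hxc)
    have h2 := add_mem_cube hx h1
    rwa [sub_add_cancel, show x - t + (c - x) = c - t by abel] at h2
  rw [hXe, volume_cube, ← ENNReal.ofReal_pow (by positivity)] at ht
  have hξ : ((ξ : Set (E d)) ∩ Ω).encard ≤ ξ.card := by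
    rw [← encard_coe_eq_coe_finsetCard]; exact encard_le_encard inter_subset_left
  set w := ENNReal.ofReal (h ^ d) * volume (Metric.ball (0 : E d) 1)
  set V := ENNReal.ofReal ((2 * a) ^ d)
  have hV0 : V ≠ 0 := by simp [V]; positivity
  refine (ENNReal.mul_le_mul_iff_left hV0 ENNReal.ofReal_ne_top).1 ?_
  calc ENNReal.ofReal D * volume Ω * V
      ≤ ENNReal.ofReal D' * volume Q * ENNReal.ofReal ((2 * (a - h)) ^ d) := hstrict.le
    _ ≤ dens d * ENNReal.ofReal ((2 * (a - h)) ^ d) * volume Q := by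
      rw [mul_right_comm]; gcongr
    _ ≤ X.card * w * volume Q := mul_le_mul_left hdens _
    _ = X.card * volume Q * w := by ring
    _ ≤ (((ξ : Set (E d)) ∩ Ω).encard : ℝ≥0∞) * V * w := mul_le_mul_left (by simpa using ht) _
    _ ≤ ξ.card * V * w := by
      gcongr
      simpa using ENat.toENNReal_le.2 hξ
    _ = ξ.card * w * V := by ring

/-! ### Asymptotics -/

/-- Nodes in the body: the centres of a covering of nearly least density, together with
`o (h ^ (-d))` additional nodes near the boundary. -/
theorem exists_nodes {D : ℝ} (hD : dens d < ENNReal.ofReal D)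
    {Ω : Set (E d)} (hconv : Convex ℝ Ω) (hcomp : IsCompact Ω) (hint : (interior Ω).Nonempty) :
    ∀ᶠ h : ℝ in 𝓝[>] 0, ∃ ξ : Finset (E d), (ξ : Set (E d)) ⊆ Ω ∧
      (ξ.card : ℝ≥0∞) * (ENNReal.ofReal (h ^ d) * volume (Metric.ball (0 : E d) 1)) ≤
        ENNReal.ofReal D * volume Ω ∧
      ∀ y ∈ Ω, (∃ x ∈ ξ, dist x y ≤ h / 2) ∨
        ∀ c ∈ Metric.closedBall y h, ∃ x ∈ ξ, dist x c ≤ h := by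
  classical
  have hΩt : volume Ω ≠ ⊤ := hcomp.measure_lt_top.ne
  have hΩ0 : volume Ω ≠ 0 :=
    ((isOpen_interior.measure_pos volume hint).trans_le (measure_mono interior_subset)).ne'
  obtain ⟨D', hD'0, hdD', hD'D⟩ : ∃ D' : ℝ, 0 ≤ D' ∧ dens d < ENNReal.ofReal D' ∧ D' < D := by
    obtain ⟨z, hz1, hz2⟩ := exists_between hD
    have hzt : z ≠ ⊤ := ne_top_of_lt hz2
    exact ⟨z.toReal, ENNReal.toReal_nonneg, by rwa [ENNReal.ofReal_toReal hzt],
      (ENNReal.lt_ofReal_iff_toReal_lt hzt).1 hz2⟩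
  -- The neighbourhood of the boundary layer in which the additional nodes are sought.
  set L : ℝ → Set (E d) := fun h => Ω ∩ Metric.cthickening (2 * h) Ωᶜ with hL
  set A : ℝ → Set (E d) := fun h => Metric.cthickening (h / 4) (L h) with hA
  have hAlim : Tendsto (fun h => volume (A h)) (𝓝[>] 0) (𝓝 0) := by
    have h1 : Tendsto (fun h => volume (Metric.cthickening h Ω) - volume Ω) (𝓝 0) (𝓝 0) := by
      have := ENNReal.Tendsto.sub (tendsto_measure_cthickening_of_isCompact
        (μ := (volume : Measure (E d))) hcomp) (tendsto_const_nhds (x := volume Ω)) (Or.inl hΩt)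
      rwa [tsub_self] at this
    have h2 : Tendsto (fun h : ℝ => volume (Ω ∩ Metric.cthickening (3 * h) Ωᶜ)) (𝓝 0) (𝓝 0) := by
      refine (tendsto_volume_boundaryLayer hconv hcomp).comp ?_
      have : Continuous fun h : ℝ => 3 * h := by fun_prop
      simpa using this.tendsto 0
    have h3 := (h1.add h2).mono_left (nhdsWithin_le_nhds (s := Ioi 0))
    rw [add_zero] at h3
    refine tendsto_of_tendsto_of_tendsto_of_le_of_le' tendsto_const_nhds h3
      (Eventually.of_forall fun _ => zero_le) ?_
    filter_upwards [self_mem_nhdsWithin] with h hh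
    have hh0 : 0 < h := hh
    have hsub : A h ⊆ (Metric.cthickening h Ω \ Ω) ∪ (Ω ∩ Metric.cthickening (3 * h) Ωᶜ) := by
      intro x hx
      by_cases hxΩ : x ∈ Ω
      · refine Or.inr ⟨hxΩ, ?_⟩
        have h4 := Metric.cthickening_cthickening_subset (ε := h / 4) (δ := 2 * h)
          (by positivity) (by positivity) Ωᶜ
          (Metric.cthickening_subset_of_subset _ inter_subset_right hx)
        exact Metric.cthickening_mono (by linarith) _ h4
      · refine Or.inl ⟨?_, hxΩ⟩
        exact Metric.cthickening_mono (by linarith : h / 4 ≤ h) _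
          (Metric.cthickening_subset_of_subset _ inter_subset_left hx)
    refine (measure_mono hsub).trans ((measure_union_le _ _).trans ?_)
    gcongr
    rw [measure_sdiff (Metric.self_subset_cthickening _)
      hcomp.isClosed.measurableSet.nullMeasurableSet hΩt]
  have hsmall : ∀ᶠ h in 𝓝[>] 0, ENNReal.ofReal (4 ^ d * D') * volume (A h) <
      ENNReal.ofReal (D - D') * volume Ω := by
    have h1 := ENNReal.Tendsto.const_mul (a := ENNReal.ofReal (4 ^ d * D')) hAlim
      (Or.inr ENNReal.ofReal_ne_top)
    rw [mul_zero] at h1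
    refine h1.eventually_lt_const (ENNReal.mul_pos ?_ hΩ0)
    simpa using hD'D
  filter_upwards [hsmall, self_mem_nhdsWithin] with h hhA hh
  have hh0 : 0 < h := hh
  obtain ⟨S₁, hS₁, X₁, hX₁, hc₁⟩ := exists_covering_card_le hD'0 hdD' hh0
    hcomp.isClosed.measurableSet hcomp.isBounded
  obtain ⟨S₂, hS₂, X₂, hX₂, hc₂⟩ := exists_covering_card_le hD'0 hdD' (h := h / 4)
    (by positivity) (A := A h) Metric.isClosed_cthickening.measurableSet
    (hcomp.isBounded.subset inter_subset_left).cthickening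
  -- Move each additional node into the body.
  have hex : ∀ s : E d, ∃ x, (∃ y ∈ L h, dist y s ≤ h / 4) → x ∈ L h ∧ dist x s ≤ h / 4 := by
    intro s
    by_cases hs : ∃ y ∈ L h, dist y s ≤ h / 4
    · obtain ⟨y, hy⟩ := hs
      exact ⟨y, fun _ => hy⟩
    · exact ⟨s, fun h => absurd h hs⟩
  choose p hp using hex
  set X₃ := X₂.filter fun s => ∃ y ∈ L h, dist y s ≤ h / 4 with hX₃
  refine ⟨X₁ ∪ X₃.image p, ?_, ?_, fun y hy => ?_⟩
  · rw [Finset.coe_union, union_subset_iff]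
    refine ⟨by rw [hX₁]; exact inter_subset_right, ?_⟩
    intro x hx
    obtain ⟨s, hs, rfl⟩ := Finset.mem_image.1 (Finset.mem_coe.1 hx)
    exact (hp s (Finset.mem_filter.1 hs).2).1.1
  · set ν := volume (Metric.ball (0 : E d) 1)
    have hcard : ((X₁ ∪ X₃.image p).card : ℝ≥0∞) ≤ X₁.card + X₂.card := by
      exact_mod_cast (Finset.card_union_le _ _).trans (Nat.add_le_add_left
        (Finset.card_image_le.trans (Finset.card_filter_le _ _)) _)
    have e1 : ENNReal.ofReal (h ^ d) = ENNReal.ofReal (4 ^ d) * ENNReal.ofReal ((h / 4) ^ d) := by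
      rw [← ENNReal.ofReal_mul (by positivity), ← mul_pow]
      congr 2; ring
    calc _ ≤ ((X₁.card : ℝ≥0∞) + X₂.card) * (ENNReal.ofReal (h ^ d) * ν) := by gcongr
      _ = X₁.card * (ENNReal.ofReal (h ^ d) * ν) +
          ENNReal.ofReal (4 ^ d) * (X₂.card * (ENNReal.ofReal ((h / 4) ^ d) * ν)) := by
        rw [add_mul]
        congr 1
        rw [e1]; ring
      _ ≤ ENNReal.ofReal D' * volume Ω +
          ENNReal.ofReal (4 ^ d) * (ENNReal.ofReal D' * volume (A h)) := by gcongr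
      _ ≤ ENNReal.ofReal D' * volume Ω + ENNReal.ofReal (D - D') * volume Ω := by
        refine add_le_add le_rfl ?_
        rw [← mul_assoc, ← ENNReal.ofReal_mul (by positivity)]
        exact hhA.le
      _ = ENNReal.ofReal D * volume Ω := by
        rw [← add_mul, ← ENNReal.ofReal_add hD'0 (by linarith), add_sub_cancel]
  · by_cases hyL : y ∈ Metric.cthickening (2 * h) Ωᶜ
    · left
      obtain ⟨s, hs, hys⟩ := hS₂.exists_dist_le y
      have hyL' : y ∈ L h := ⟨hy, hyL⟩
      have hsA : s ∈ A h := Metric.mem_cthickening_of_dist_le s y _ _ hyL' (by rwa [dist_comm])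
      have hsX : s ∈ X₂ := by
        rw [← Finset.mem_coe, hX₂]; exact ⟨hs, hsA⟩
      have hps := (hp s ⟨y, hyL', hys⟩).2
      refine ⟨p s, Finset.mem_union_right _ (Finset.mem_image_of_mem p
        (Finset.mem_filter.2 ⟨hsX, y, hyL', hys⟩)), ?_⟩
      calc dist (p s) y ≤ dist (p s) s + dist y s := dist_triangle_right _ _ _
        _ ≤ h / 2 := by linarith
    · right
      intro c hc
      obtain ⟨s, hs, hcs⟩ := hS₁.exists_dist_le c
      have hsΩ : s ∈ Ω := closedBall_subset_of_notMem_layer hyL (by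
        rw [Metric.mem_closedBall] at hc ⊢
        calc dist s y ≤ dist c s + dist c y := dist_triangle_left _ _ _
          _ ≤ 2 * h := by linarith)
      refine ⟨s, Finset.mem_union_left _ ?_, by rwa [dist_comm]⟩
      rw [← Finset.mem_coe, hX₁]; exact ⟨hs, hsΩ⟩

/-- The radius `(κ / n) ^ (1 / d)` of `n` balls whose total volume is `dens d` times the volume of
the body, where `κ = dens d * μ(Ω) / ν_d`. -/
noncomputable def criticalRadius (d : ℕ) (κ : ℝ) (n : ℕ) : ℝ := (κ / n) ^ (1 / (d : ℝ))

theorem criticalRadius_pos {κ : ℝ} (hκ : 0 < κ) {n : ℕ} (hn : 0 < n) :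
    0 < criticalRadius d κ n :=
  Real.rpow_pos_of_pos (div_pos hκ (by exact_mod_cast hn)) _

theorem criticalRadius_pow (hd : 0 < d) {κ : ℝ} (hκ : 0 < κ) (n : ℕ) :
    criticalRadius d κ n ^ d = κ / n := by
  rw [criticalRadius, ← Real.rpow_natCast, ← Real.rpow_mul (by positivity),
    one_div_mul_cancel (by exact_mod_cast hd.ne'), Real.rpow_one]

theorem criticalRadius_sq {κ : ℝ} (hκ : 0 < κ) (n : ℕ) :
    criticalRadius d κ n ^ 2 = (κ / n) ^ (2 / (d : ℝ)) := by
  rw [criticalRadius, ← Real.rpow_natCast, ← Real.rpow_mul (by positivity)]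
  congr 1
  push_cast
  ring

theorem tendsto_criticalRadius (hd : 0 < d) (κ : ℝ) :
    Tendsto (criticalRadius d κ) atTop (𝓝 0) := by
  have h1 : Tendsto (fun n : ℕ => κ / n) atTop (𝓝 0) := tendsto_const_div_atTop_nhds_zero_nat κ
  have hpos : 0 < 1 / (d : ℝ) := by positivity
  have h2 := h1.rpow_const (p := 1 / (d : ℝ)) (Or.inr hpos.le)
  rwa [Real.zero_rpow hpos.ne'] at h2

/-- `κ = dens d * μ(Ω) / ν_d` as a real number. -/
theorem exists_kappa (hd : 0 < d) {Ω : Set (E d)} (hcomp : IsCompact Ω)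
    (hint : (interior Ω).Nonempty) :
    ∃ κ : ℝ, 0 < κ ∧ dens d * volume Ω = ENNReal.ofReal κ * volume (Metric.ball (0 : E d) 1) := by
  have hΩt : volume Ω ≠ ⊤ := hcomp.measure_lt_top.ne
  have hΩ0 : volume Ω ≠ 0 :=
    ((isOpen_interior.measure_pos volume hint).trans_le (measure_mono interior_subset)).ne'
  have hd0 : dens d ≠ 0 := (one_pos.trans_le (one_le_dens d)).ne'
  set x := dens d * volume Ω / volume (Metric.ball (0 : E d) 1) with hx
  have hxt : x ≠ ⊤ := ENNReal.div_ne_top (ENNReal.mul_ne_top (dens_ne_top hd) hΩt)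
    volume_unit_ball_ne_zero
  have hx0 : x ≠ 0 := ENNReal.div_ne_zero.2 ⟨mul_ne_zero hd0 hΩ0, volume_unit_ball_ne_top⟩
  refine ⟨x.toReal, ENNReal.toReal_pos hx0 hxt, ?_⟩
  rw [ENNReal.ofReal_toReal hxt, hx,
    ENNReal.div_mul_cancel volume_unit_ball_ne_zero volume_unit_ball_ne_top]

/-- The radius `h = l * (κ / n) ^ (1 / d)` with `l > 1` is just large enough for `exists_nodes` to
need at most `n` nodes. -/
theorem eventually_nthOptimalError_le (hd : 0 < d) {Ω : Set (E d)} (hconv : Convex ℝ Ω)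
    (hcomp : IsCompact Ω) (hint : (interior Ω).Nonempty) (q : ℝ) {κ : ℝ} (hκ : 0 < κ)
    (hκΩ : dens d * volume Ω = ENNReal.ofReal κ * volume (Metric.ball (0 : E d) 1)) {θ : ℝ}
    (hθ : 1 < θ) :
    ∀ᶠ n : ℕ in atTop, nthOptimalError Ω (W 0 q Ω) n ≤
      ENNReal.ofReal (θ * (criticalRadius d κ n ^ 2 / 4)) := by
  obtain ⟨l, hl1, hlθ⟩ : ∃ l : ℝ, 1 < l ∧ l ^ 2 < θ := by
    have h1 : ∀ᶠ l : ℝ in 𝓝 1, l ^ 2 < θ :=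
      (by fun_prop : Continuous fun l : ℝ => l ^ 2).continuousAt.eventually_lt_const (by simpa)
    obtain ⟨l, h2, h3⟩ := ((h1.filter_mono (nhdsWithin_le_nhds (s := Ioi 1))).and
      self_mem_nhdsWithin).exists
    exact ⟨l, h3, h2⟩
  have hl0 : 0 < l := one_pos.trans hl1
  set D₀ := (dens d).toReal with hD₀
  have hdens : dens d = ENNReal.ofReal D₀ := (ENNReal.ofReal_toReal (dens_ne_top hd)).symm
  have hD₀0 : 0 < D₀ := ENNReal.toReal_pos (one_pos.trans_le (one_le_dens d)).ne' (dens_ne_top hd)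
  have hld : 1 < l ^ d := one_lt_pow₀ hl1 hd.ne'
  have hDlt : dens d < ENNReal.ofReal (l ^ d * D₀) := by
    rw [hdens]
    exact (ENNReal.ofReal_lt_ofReal_iff (by positivity)).2 (lt_mul_of_one_lt_left hD₀0 hld)
  have hr : Tendsto (fun n => l * criticalRadius d κ n) atTop (𝓝 0) := by
    have h1 := (tendsto_criticalRadius hd κ).const_mul l
    rwa [mul_zero] at h1
  have hr' : Tendsto (fun n => l * criticalRadius d κ n) atTop (𝓝[>] 0) := by
    refine tendsto_nhdsWithin_iff.2 ⟨hr, ?_⟩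
    filter_upwards [eventually_gt_atTop 0] with n hn using
      mul_pos hl0 (criticalRadius_pos hκ hn)
  have hq : ∀ᶠ n in atTop, l ^ 2 < θ * (1 - |q| * (l * criticalRadius d κ n) ^ 2 / 4) := by
    have h1 : Continuous fun h : ℝ => θ * (1 - |q| * h ^ 2 / 4) := by fun_prop
    exact hr.eventually ((h1.tendsto 0).eventually_const_lt
      (by rwa [show θ * (1 - |q| * 0 ^ 2 / 4) = θ by ring]))
  filter_upwards [hr'.eventually (exists_nodes hDlt hconv hcomp hint), hq,
    eventually_gt_atTop 0] with n ⟨ξ, hξ, hcard, hcov⟩ hqn hn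
  set h := l * criticalRadius d κ n with hh
  have hh0 : 0 < h := mul_pos hl0 (criticalRadius_pos hκ hn)
  have hn0 : (0 : ℝ) < n := by exact_mod_cast hn
  have hhd : h ^ d = l ^ d * κ / n := by rw [hh, mul_pow, criticalRadius_pow hd hκ, mul_div_assoc]
  have hcn : ξ.card ≤ n := by
    have e : ENNReal.ofReal (l ^ d * D₀) * volume Ω = ENNReal.ofReal (l ^ d * κ) *
        volume (Metric.ball (0 : E d) 1) := by
      rw [ENNReal.ofReal_mul (by positivity), ENNReal.ofReal_mul (by positivity), mul_assoc,
        ← hdens, hκΩ, mul_assoc]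
    rw [e, ← mul_assoc, ENNReal.mul_le_mul_iff_left volume_unit_ball_ne_zero
      volume_unit_ball_ne_top, ← ENNReal.ofReal_natCast, ← ENNReal.ofReal_mul (Nat.cast_nonneg _),
      ENNReal.ofReal_le_ofReal_iff (mul_nonneg (pow_nonneg hl0.le d) hκ.le), hhd,
      mul_div_assoc', div_le_iff₀ hn0, mul_comm] at hcard
    exact_mod_cast le_of_mul_le_mul_left hcard (by positivity)
  have hpos : 0 < 1 - |q| * h ^ 2 / 4 := by
    by_contra! hneg
    nlinarith [sq_nonneg l]
  calc nthOptimalError Ω (W 0 q Ω) n ≤ optimalError Ω (W 0 q Ω) ξ :=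
        iInf_le_of_le ξ (iInf_le_of_le hξ (iInf_le_of_le hcn le_rfl))
    _ ≤ ENNReal.ofReal (h ^ 2 / 4 / (1 - |q| * h ^ 2 / 4)) :=
        optimalError_le_of_covering hconv hcomp hint hh0 (by linarith) hξ hcov
    _ ≤ _ := by
        refine ENNReal.ofReal_le_ofReal ?_
        rw [div_le_iff₀ hpos]
        have h1 : 0 ≤ criticalRadius d κ n ^ 2 / 4 := by positivity
        have h2 := mul_le_mul_of_nonneg_right hqn.le h1
        calc h ^ 2 / 4 = l ^ 2 * (criticalRadius d κ n ^ 2 / 4) := by rw [hh]; ring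
          _ ≤ _ := h2
          _ = _ := by ring

/-- For `h = l * (κ / n) ^ (1 / d)` with `l < 1`, no `n` balls of radius `h` cover the body. -/
theorem eventually_le_nthOptimalError (hd : 0 < d) {Ω : Set (E d)} (hconv : Convex ℝ Ω)
    (hcomp : IsCompact Ω) (hint : (interior Ω).Nonempty) (q : ℝ) {κ : ℝ} (hκ : 0 < κ)
    (hκΩ : dens d * volume Ω = ENNReal.ofReal κ * volume (Metric.ball (0 : E d) 1)) {θ : ℝ}
    (hθ : θ < 1) :
    ∀ᶠ n : ℕ in atTop, ENNReal.ofReal (θ * (criticalRadius d κ n ^ 2 / 4)) ≤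
      nthOptimalError Ω (W 0 q Ω) n := by
  obtain ⟨l, hl0, hl1, hlθ⟩ : ∃ l : ℝ, 0 < l ∧ l < 1 ∧ θ < l ^ 2 := by
    have h1 : ∀ᶠ l : ℝ in 𝓝 1, θ < l ^ 2 :=
      (by fun_prop : Continuous fun l : ℝ => l ^ 2).continuousAt.eventually_const_lt (by simpa)
    obtain ⟨l, ⟨h2, h4⟩, h3⟩ := (((h1.and (eventually_gt_nhds (zero_lt_one' ℝ))).filter_mono
      (nhdsWithin_le_nhds (s := Iio 1))).and self_mem_nhdsWithin).exists
    exact ⟨l, h4, h3, h2⟩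
  set D₀ := (dens d).toReal with hD₀
  have hdens : dens d = ENNReal.ofReal D₀ := (ENNReal.ofReal_toReal (dens_ne_top hd)).symm
  have hD₀0 : 0 < D₀ := ENNReal.toReal_pos (one_pos.trans_le (one_le_dens d)).ne' (dens_ne_top hd)
  obtain ⟨m, hlm, hm1⟩ : ∃ m, l ^ d < m ∧ m < 1 := exists_between (pow_lt_one₀ hl0.le hl1 hd.ne')
  have hm0 : 0 < m := (pow_pos hl0 d).trans hlm
  have hDlt : ENNReal.ofReal (m * D₀) < dens d := by
    rw [hdens]
    exact (ENNReal.ofReal_lt_ofReal_iff hD₀0).2 (mul_lt_of_lt_one_left hD₀0 hm1)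
  obtain ⟨h₀, hh₀, hcover⟩ := le_card_of_cover (mul_pos hm0 hD₀0) hDlt hconv hcomp hint
  have hr : Tendsto (fun n => l * criticalRadius d κ n) atTop (𝓝 0) := by
    have h1 := (tendsto_criticalRadius hd κ).const_mul l
    rwa [mul_zero] at h1
  have hq : ∀ᶠ n in atTop, θ * (1 + |q| * (l * criticalRadius d κ n) ^ 2 / 4) < l ^ 2 := by
    have h1 : Continuous fun h : ℝ => θ * (1 + |q| * h ^ 2 / 4) := by fun_prop
    exact hr.eventually ((h1.tendsto 0).eventually_lt_const
      (by rwa [show θ * (1 + |q| * 0 ^ 2 / 4) = θ by ring]))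
  filter_upwards [hr.eventually (eventually_lt_nhds hh₀), hq, eventually_gt_atTop 0]
    with n hhn hqn hn
  set h := l * criticalRadius d κ n with hh
  have hh0 : 0 < h := mul_pos hl0 (criticalRadius_pos hκ hn)
  have hn0 : (0 : ℝ) < n := by exact_mod_cast hn
  have hhd : h ^ d = l ^ d * κ / n := by rw [hh, mul_pow, criticalRadius_pow hd hκ, mul_div_assoc]
  refine le_iInf fun ξ => le_iInf fun hξ => le_iInf fun hcn => ?_
  obtain ⟨y, hy, hyξ⟩ : ∃ y ∈ Ω, ∀ x ∈ ξ, h < dist x y := by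
    by_contra! hno
    have h1 := hcover h hh0 hhn ξ fun y hy => by
      obtain ⟨x, hx, hxy⟩ := hno y hy
      exact ⟨x, hx, by rwa [dist_comm]⟩
    have e : ENNReal.ofReal (m * D₀) * volume Ω = ENNReal.ofReal (m * κ) *
        volume (Metric.ball (0 : E d) 1) := by
      rw [ENNReal.ofReal_mul (by positivity), ENNReal.ofReal_mul (by positivity), mul_assoc,
        ← hdens, hκΩ, mul_assoc]
    rw [e, ← mul_assoc, ENNReal.mul_le_mul_iff_left volume_unit_ball_ne_zero
      volume_unit_ball_ne_top, ← ENNReal.ofReal_natCast, ← ENNReal.ofReal_mul (Nat.cast_nonneg _),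
      ENNReal.ofReal_le_ofReal_iff (mul_nonneg (Nat.cast_nonneg _) (pow_nonneg hh0.le d)),
      hhd] at h1
    have h2 : (ξ.card : ℝ) ≤ n := by exact_mod_cast hcn
    have h3 : (ξ.card : ℝ) * (l ^ d * κ / n) ≤ n * (l ^ d * κ / n) := by gcongr
    rw [mul_div_cancel₀ _ hn0.ne'] at h3
    nlinarith
  refine le_trans (ENNReal.ofReal_le_ofReal ?_)
    (le_optimalError_of_empty_ball hconv hcomp.isClosed hint hh0 hy hyξ)
  rw [le_div_iff₀ (by positivity)]
  have h1 : 0 ≤ criticalRadius d κ n ^ 2 / 4 := by positivity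
  have h2 := mul_le_mul_of_nonneg_right hqn.le h1
  calc θ * (criticalRadius d κ n ^ 2 / 4) * (1 + |q| * h ^ 2 / 4) =
      θ * (1 + |q| * h ^ 2 / 4) * (criticalRadius d κ n ^ 2 / 4) := by ring
    _ ≤ _ := h2
    _ = h ^ 2 / 4 := by rw [hh]; ring

end OptimalRecovery

theorem theorem2 (d : ℕ) (hd : 0 < d) (Ω : Set (OptimalRecovery.E d))
    (hconv : Convex ℝ Ω) (hclosed : IsClosed Ω) (hbdd : Bornology.IsBounded Ω)
    (hint : (interior Ω).Nonempty) (q : ℝ) :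
    ∃ ε : ℕ → ℝ, Tendsto ε atTop (𝓝 0) ∧
      ∀ᶠ n : ℕ in atTop,
        OptimalRecovery.nthOptimalError Ω (OptimalRecovery.W 0 q Ω) n =
          1 / 4 *
            (OptimalRecovery.dens d * volume Ω /
              (volume (Metric.ball (0 : OptimalRecovery.E d) 1) * (n : ℝ≥0∞))) ^ (2 / (d : ℝ)) *
            ENNReal.ofReal (1 + ε n) := by
  open OptimalRecovery in
  have hcomp : IsCompact Ω := Metric.isCompact_of_isClosed_isBounded hclosed hbdd
  obtain ⟨κ, hκ, hκΩ⟩ := exists_kappa hd hcomp hint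
  set r : ℕ → ℝ := fun n => criticalRadius d κ n ^ 2 / 4 with hr
  have hrpos : ∀ n : ℕ, 0 < n → 0 < r n := fun n hn => by
    have := criticalRadius_pos (d := d) hκ hn
    positivity
  have hupper := fun {θ : ℝ} (hθ : 1 < θ) =>
    eventually_nthOptimalError_le hd hconv hcomp hint q hκ hκΩ hθ
  have hlower := fun {θ : ℝ} (hθ : θ < 1) =>
    eventually_le_nthOptimalError hd hconv hcomp hint q hκ hκΩ hθ
  refine ⟨fun n => (nthOptimalError Ω (W 0 q Ω) n).toReal / r n - 1, ?_, ?_⟩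
  · refine tendsto_order.2 ⟨fun a ha => ?_, fun b hb => ?_⟩
    · filter_upwards [hlower (θ := 1 + a / 2) (by linarith), hupper one_lt_two,
        eventually_gt_atTop 0] with n hlow hup hn
      have htop := ne_top_of_le_ne_top ENNReal.ofReal_ne_top hup
      have h1 := (ENNReal.ofReal_le_iff_le_toReal htop).1 hlow
      rw [← le_div_iff₀ (hrpos n hn)] at h1
      linarith
    · filter_upwards [hupper (θ := 1 + b / 2) (by linarith), eventually_gt_atTop 0] with n hup hn
      have h0 := hrpos n hn
      have h1 := ENNReal.toReal_le_of_le_ofReal (by positivity) hup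
      rw [← div_le_iff₀ h0] at h1
      linarith
  · filter_upwards [hupper one_lt_two, eventually_gt_atTop 0] with n hup hn
    have htop : nthOptimalError Ω (W 0 q Ω) n ≠ ⊤ := ne_top_of_le_ne_top ENNReal.ofReal_ne_top hup
    have hn0 : (0 : ℝ) < n := by exact_mod_cast hn
    have e1 : dens d * volume Ω / (volume (Metric.ball (0 : E d) 1) * (n : ℝ≥0∞)) =
        ENNReal.ofReal (κ / n) := by
      rw [hκΩ, mul_comm (volume _), ENNReal.mul_div_mul_right _ _ volume_unit_ball_ne_zero
        volume_unit_ball_ne_top, ENNReal.ofReal_div_of_pos hn0, ENNReal.ofReal_natCast]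
    have e2 : (1 / 4 : ℝ≥0∞) = ENNReal.ofReal (1 / 4) := by
      rw [ENNReal.ofReal_div_of_pos (by norm_num)]; norm_num
    rw [e1, e2, ENNReal.ofReal_rpow_of_pos (by positivity), ← criticalRadius_sq hκ,
      ← ENNReal.ofReal_mul (by positivity), ← ENNReal.ofReal_mul (by positivity),
      add_sub_cancel, show 1 / 4 * criticalRadius d κ n ^ 2 = r n by simp only [hr]; ring,
      mul_div_cancel₀ _ (hrpos n hn).ne', ENNReal.ofReal_toReal htop]
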